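/- Let $n\ge 1$, and let $\varphi\in\mathscr S(\mathbb R^n)$ satisfy $\operatorname{supp}\varphi\subset\{1/2\le|\xi|\le2\}$, $\varphi(\xi)>0$ for $1/2<|\xi|<2$ and $\sum_{k\in\mathbb Z}\varphi(2^{-k}\xi)=1$ for $\xi\ne0$; define $\varphi_k$ by $\int_{\mathbb R^n}\varphi_k(x)e^{-i(\xi,x)}\,dx=\varphi(2^{-k}\xi)$, $k\in\mathbb Z$. Let $\dot{\mathscr S}$ be the space of all $g\in\mathscr S(\mathbb R^n)$ whose Fourier transform vanishes at $0$ together with all its derivatives, with the topology induced from $\mathscr S(\mathbb R^n)$, and let $\dot{\mathscr S}'$ be the space of continuous linear functionals on it. For $f\in\dot{\mathscr S}'$ put $(\varphi_k*f)(x)=\langle f,\varphi_k(x-\cdot)\rangle$. For $0<p\le\infty$ and $w:\mathbb R^n\to(0,\infty)$ measurable let $\|g\|_{L_p(w)}=(\int|g|^pw\,dx)^{1/p}$ if $p<\infty$ and $\|g\|_{L_\infty(w)}=\operatorname{ess\,sup}|g|w$. For $s\in\mathbb R$ and $0<q\le\infty$, the space $\dot B^s_{p,q}(w)$ consists of all $f\in\dot{\mathscr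 S}'$ with $$\|f\|_{\dot B^s_{p,q}(w)}=\Big(\sum_{k\in\mathbb Z}2^{sqk}\|\varphi_k*f\|_{L_p(w)}^q\Big)^{1/q}<\infty$$ (with $\sup_{k}2^{sk}\|\varphi_k*f\|_{L_p(w)}$ if $q=\infty$), and $\dot B^s_{p,q}=\dot B^s_{p,q}(1)$. **Theorem.** Let either $0<q<p<r\le\infty$ or $0<r<p<q\le\infty$, let $\tau,\sigma,s\in\mathbb R$ with $\sigma<s$, and let $0<\eta<\infty$. Set $\gamma=\frac{p-q}{r-q}$ if $q<p$ and $\gamma=\frac{q-p}{q-r}$ if $r<p$ (so $\gamma=0$ if $r=\infty$, and $\gamma=1$ if $q=\infty$), and put $1/\infty=0$. Suppose that $\sigma-\tau<n(\frac1q-\frac1p)$ if $q<p$, that $n(\frac1r-\frac1p)<s-\tau$ if $r<p$, and that $$\frac{1-\theta}{q}+\frac{\theta}{r}>\frac1p,\qquad \theta=\frac{\tau-\sigma}{s-\sigma}.$$ Then there is a constant $C$, depending only on $n,\varphi,p,q,r,\tau,\sigma,s,\eta$, such that the following holds for all measurable $u,v:\mathbb R^n\to\mathbb R$ with $u(x)v(x)\ge1$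 for all $x$, with $u(x)\ge1$ for all $x$ if $q<p$, and with $v(x)\ge1$ for all $x$ if $r<p$. If $$f\in\dot B^\sigma_{q,\infty}(u^{1/(1-\gamma)})\cap\dot B^s_{r,\infty}(v^{1/\gamma}),$$ then $f\in\dot B^\tau_{p,\eta}$; and if, in addition, $s-\frac nr\ne\sigma-\frac nq$, then $$\|f\|_{\dot B^\tau_{p,\eta}}\le C\,\|f\|_{\dot B^\sigma_{q,\infty}(u^{1/(1-\gamma)})}^{1-\delta}\,\|f\|_{\dot B^s_{r,\infty}(v^{1/\gamma})}^{\delta},\qquad \delta=\frac{\tau-\sigma+n(\frac1q-\frac1p)}{s-\sigma+n(\frac1q-\frac1r)}.$$ Here, if $r=\infty$, the weight $v^{1/\gamma}$ is understood as $v^{1/(p-q)}$, and if $q=\infty$, the weight $u^{1/(1-\gamma)}$ is understood as $u^{1/(p-r)}$ (the limits of $(v^{1/\gamma})^{1/r}$ as $r\to\infty$ and of $(u^{1/(1-\gamma)})^{1/q}$ as $q\to\infty$). -/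

import Mathlib

open MeasureTheory FourierTransform SchwartzMap
open scoped ENNReal NNReal

namespace WeightedBesov

/-- The Euclidean space `ℝⁿ`. -/
abbrev E (n : ℕ) : Type := EuclideanSpace ℝ (Fin n)

/-- The closed subspace of the Schwartz space consisting of the functions whose Fourier transform
vanishes at the origin together with all its derivatives. -/
noncomputable def dotSchwartz (n : ℕ) : Submodule ℂ 𝓢(E n, ℂ) where
  carrier := {g | ∀ m : ℕ, iteratedFDeriv ℝ m (𝓕 g : 𝓢(E n, ℂ)) 0 = 0}
  zero_mem' := by
    intro m
    have h : ((𝓕 (0 : 𝓢(E n, ℂ)) : 𝓢(E n, ℂ)) : E n → ℂ) = fun _ => 0 := by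
      rw [FourierTransform.fourier_zero]; rfl
    rw [h, iteratedFDeriv_fun_zero]; rfl
  add_mem' := by
    intro f g hf hg m
    have h : ((𝓕 (f + g) : 𝓢(E n, ℂ)) : E n → ℂ)
        = ((𝓕 f : 𝓢(E n, ℂ)) : E n → ℂ) + ((𝓕 g : 𝓢(E n, ℂ)) : E n → ℂ) := by
      rw [FourierTransform.fourier_add]; rfl
    rw [h, iteratedFDeriv_add_apply ((𝓕 f : 𝓢(E n, ℂ)).smooth m).contDiffAt
      ((𝓕 g : 𝓢(E n, ℂ)).smooth m).contDiffAt, hf m, hg m, add_zero]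
  smul_mem' := by
    intro c f hf m
    have h : ((𝓕 (c • f) : 𝓢(E n, ℂ)) : E n → ℂ)
        = c • ((𝓕 f : 𝓢(E n, ℂ)) : E n → ℂ) := by
      rw [FourierTransform.fourier_smul]; rfl
    rw [h, iteratedFDeriv_const_smul_apply ((𝓕 f : 𝓢(E n, ℂ)).smooth m).contDiffAt, hf m,
      smul_zero]

/-- The space of continuous linear functionals on `dotSchwartz n`, which carries the topology
induced from the Schwartz space. -/
abbrev DotDistribution (n : ℕ) : Type := dotSchwartz n →L[ℂ] ℂ

/-- A smooth dyadic partition of unity of `ℝⁿ ∖ {0}`, generated by one function `φ`. -/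
structure DyadicPartition (n : ℕ) where
  /-- the generating function -/
  φ : 𝓢(E n, ℂ)
  support_subset : Function.support φ ⊆ {ξ | 1 / 2 ≤ ‖ξ‖ ∧ ‖ξ‖ ≤ 2}
  pos : ∀ ξ, 1 / 2 < ‖ξ‖ → ‖ξ‖ < 2 → 0 < (φ ξ).re ∧ (φ ξ).im = 0
  hasSum_one : ∀ ξ, ξ ≠ 0 → HasSum (fun k : ℤ => φ ((2 : ℝ) ^ (-k) • ξ)) 1

/-- The dilation `y ↦ c y` of `ℝⁿ`, for `c ≠ 0`. -/
noncomputable def dilation (n : ℕ) (c : ℝ) (hc : c ≠ 0) : E n ≃L[ℝ] E n :=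
  ContinuousLinearEquiv.smulLeft (Units.mk0 c hc)

theorem dilation_apply (n : ℕ) (c : ℝ) (hc : c ≠ 0) (y : E n) : dilation n c hc y = c • y := rfl

theorem scale_ne_zero (k : ℤ) : (2 : ℝ) ^ (-k) * (2 * Real.pi) ≠ 0 := by positivity

/-- The kernel `φ_k`, determined by `∫ φ_k(x) e^{-i(ξ, x)} dx = φ(2^{-k} ξ)`
(see `DyadicPartition.integral_kernel`). The factor `2π` appears because `𝓕` is
`∫ f(x) e^{-2πi(ξ, x)} dx`. -/
noncomputable def DyadicPartition.kernel {n : ℕ} (P : DyadicPartition n) (k : ℤ) : 𝓢(E n, ℂ) :=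
  𝓕⁻ (compCLMOfContinuousLinearEquiv ℂ
    (dilation n ((2 : ℝ) ^ (-k) * (2 * Real.pi)) (scale_ne_zero k)) P.φ)

theorem DyadicPartition.fourier_kernel {n : ℕ} (P : DyadicPartition n) (k : ℤ) (η : E n) :
    (𝓕 (P.kernel k : E n → ℂ)) η = P.φ (((2 : ℝ) ^ (-k) * (2 * Real.pi)) • η) := by
  rw [← SchwartzMap.fourier_coe, DyadicPartition.kernel, FourierTransform.fourier_fourierInv_eq]
  rfl

theorem DyadicPartition.integral_kernel {n : ℕ} (P : DyadicPartition n) (k : ℤ) (ξ : E n) :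
    ∫ x : E n, P.kernel k x * Complex.exp (-Complex.I * (inner ℝ ξ x : ℝ))
      = P.φ ((2 : ℝ) ^ (-k) • ξ) := by
  have h := P.fourier_kernel k ((2 * Real.pi)⁻¹ • ξ)
  rw [smul_smul, mul_assoc, mul_inv_cancel₀ (by positivity), mul_one, Real.fourier_eq'] at h
  rw [← h]
  refine integral_congr_ae (Filter.Eventually.of_forall fun x => ?_)
  simp only [smul_eq_mul]
  rw [mul_comm, real_inner_comm, inner_smul_right]
  congr 2
  push_cast
  field_simp

/-- The Schwartz function `y ↦ g(x - y)`. -/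
noncomputable def reflectTranslate {n : ℕ} (g : 𝓢(E n, ℂ)) (x : E n) : 𝓢(E n, ℂ) :=
  compSubConstCLM ℂ x (compCLMOfContinuousLinearEquiv ℂ (ContinuousLinearEquiv.neg ℝ) g)

theorem reflectTranslate_apply {n : ℕ} (g : 𝓢(E n, ℂ)) (x y : E n) :
    reflectTranslate g x y = g (x - y) := by
  simp [reflectTranslate]

theorem fourier_reflectTranslate {n : ℕ} (g : 𝓢(E n, ℂ)) (x η : E n) :
    (𝓕 (reflectTranslate g x : E n → ℂ)) η
      = Complex.exp (((-2 * Real.pi * inner ℝ x η : ℝ) : ℂ) * Complex.I)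
        * 𝓕 (g : E n → ℂ) (-η) := by
  rw [Real.fourier_eq', Real.fourier_eq', ← integral_sub_left_eq_self _ volume x,
    ← integral_const_mul]
  refine integral_congr_ae (Filter.Eventually.of_forall fun y => ?_)
  simp only [smul_eq_mul, reflectTranslate_apply, sub_sub_cancel]
  rw [← mul_assoc, ← Complex.exp_add]
  congr 2
  rw [inner_sub_left, inner_neg_right]
  push_cast
  ring

theorem DyadicPartition.reflectTranslate_mem {n : ℕ} (P : DyadicPartition n) (k : ℤ) (x : E n) :
    reflectTranslate (P.kernel k) x ∈ dotSchwartz n := by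
  intro m
  have h0 : ((𝓕 (reflectTranslate (P.kernel k) x) : 𝓢(E n, ℂ)) : E n → ℂ)
      =ᶠ[nhds 0] fun _ => 0 := by
    have hc : Filter.Tendsto (fun η : E n => ‖((2 : ℝ) ^ (-k) * (2 * Real.pi)) • (-η)‖)
        (nhds 0) (nhds 0) := by
      have : Continuous (fun η : E n => ‖((2 : ℝ) ^ (-k) * (2 * Real.pi)) • (-η)‖) := by fun_prop
      simpa using this.tendsto 0
    filter_upwards [hc.eventually (gt_mem_nhds (show (0 : ℝ) < 1 / 2 by norm_num))] with η hη
    rw [SchwartzMap.fourier_coe, fourier_reflectTranslate, P.fourier_kernel]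
    have : P.φ (((2 : ℝ) ^ (-k) * (2 * Real.pi)) • (-η)) = 0 := by
      by_contra hne
      exact absurd (P.support_subset hne).1 (not_le.mpr hη)
    rw [this, mul_zero]
  rw [(h0.iteratedFDeriv ℝ m).eq_of_nhds, iteratedFDeriv_fun_zero]; rfl

/-- The function `φ_k * f`, that is `x ↦ ⟨f, φ_k(x - ·)⟩`. -/
noncomputable def DyadicPartition.conv {n : ℕ} (P : DyadicPartition n) (k : ℤ)
    (f : DotDistribution n) (x : E n) : ℂ :=
  f ⟨reflectTranslate (P.kernel k) x, P.reflectTranslate_mem k x⟩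

/-- The weighted (quasi)norm `‖g‖_{L_p(w)}`: `(∫ |g|^p w)^{1/p}` for `p < ∞`, and
`ess sup |g| w` for `p = ∞`. -/
noncomputable def weightedLpNorm {n : ℕ} (p : ℝ≥0∞) (w : E n → ℝ) (g : E n → ℂ) : ℝ≥0∞ :=
  if p = ∞ then essSup (fun x => ‖g x‖ₑ * ENNReal.ofReal (w x)) volume
  else (∫⁻ x, ‖g x‖ₑ ^ p.toReal * ENNReal.ofReal (w x)) ^ (1 / p.toReal)

/-- The weighted homogeneous Besov (quasi)norm `‖f‖_{Ḃ^s_{p,q}(w)}`. -/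
noncomputable def besovNorm {n : ℕ} (P : DyadicPartition n) (s : ℝ) (p q : ℝ≥0∞) (w : E n → ℝ)
    (f : DotDistribution n) : ℝ≥0∞ :=
  if q = ∞ then ⨆ k : ℤ, (2 : ℝ≥0∞) ^ (s * k) * weightedLpNorm p w (P.conv k f)
  else (∑' k : ℤ, ((2 : ℝ≥0∞) ^ (s * k) * weightedLpNorm p w (P.conv k f)) ^ q.toReal)
    ^ (1 / q.toReal)

/-- The weighted homogeneous Besov space `Ḃ^s_{p,q}(w)`. -/
def besovSpace {n : ℕ} (P : DyadicPartition n) (s : ℝ) (p q : ℝ≥0∞) (w : E n → ℝ) :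
    Set (DotDistribution n) :=
  {f | besovNorm P s p q w f < ∞}

/-- `γ = (p - q) / (r - q)` if `q < p`, and `γ = (q - p) / (q - r)` if `r < p`; this is `0` for
`q < p < r = ∞`, and `1` for `r < p < q = ∞` (where `∞ / ∞ = 1`). -/
noncomputable def gammaExp (p q r : ℝ≥0∞) : ℝ :=
  if r = ∞ then 0
  else if q = ∞ then 1
  else if q < p then (p.toReal - q.toReal) / (r.toReal - q.toReal)
  else (q.toReal - p.toReal) / (q.toReal - r.toReal)

/-- The weight `u^{1/(1-γ)}`. For `q = ∞`, where `γ = 1`, the weight of `L_∞` is `u^{1/(p-r)}`,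
the limit of `(u^{1/(1-γ)})^{1/q}` as `q → ∞`. -/
noncomputable def weightU {n : ℕ} (p q r : ℝ≥0∞) (u : E n → ℝ) (x : E n) : ℝ :=
  if q = ∞ then u x ^ (1 / (p.toReal - r.toReal)) else u x ^ (1 / (1 - gammaExp p q r))

/-- The weight `v^{1/γ}`. For `r = ∞`, where `γ = 0`, the weight of `L_∞` is `v^{1/(p-q)}`,
the limit of `(v^{1/γ})^{1/r}` as `r → ∞`. -/
noncomputable def weightV {n : ℕ} (p q r : ℝ≥0∞) (v : E n → ℝ) (x : E n) : ℝ :=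
  if r = ∞ then v x ^ (1 / (p.toReal - q.toReal)) else v x ^ (1 / gammaExp p q r)

/-- The reciprocal `1 / p` of `0 < p ≤ ∞` as a real number, with `1 / ∞ = 0`. -/
noncomputable def recip (p : ℝ≥0∞) : ℝ := (p⁻¹).toReal

end WeightedBesov

namespace WeightedBesov

/-! ### Translates of Schwartz functions under a tempered distribution -/

section Schwartz

variable {n : ℕ}

/-! Suppose `q < p < r`, let `A` and `B` be the two given norms of `f`, and define `β` by `1/p =
(1-β)/q + β/r`. The block `φ_k * f` satisfies two bounds in `L_p`. Nikolskii's inequality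
(`exists_weightedLpNorm_conv_le`) and `u ≥ 1` bound `2^{τk} ‖φ_k * f‖_p` by a multiple of `A 2^{ak}`
with `a = τ - σ + n(1/q - 1/p)`. Hölder's inequality and `uv ≥ 1` (`weightedLpNorm_le_mul`) bound it
by `A^{1-β} B^β 2^{-bk}` with `b = (1-β)σ + βs - τ`. The hypotheses say exactly that `a > 0` and `b
> 0`, so one geometric bound decays as `k → -∞` and the other as `k → ∞`. Summing the smaller of the
two (`exists_tsum_rpow_le`) gives every `ℓ_η` norm and the product of powers of `A` and `B`; here `a
+ b = β(s - σ + n(1/q - 1/r))` yields the exponent `δ`.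

If `r < p < q`, exchanging `(q, σ, u)` with `(r, s, v)` turns `δ` into `1 - δ` and makes both `a`
and `b` negative. The summation is unaffected by this, up to `k ↦ -k`.

Nikolskii's inequality for `q < 1` needs care, because `f` is only a functional and `φ_k * f` is not
known to be bounded. Factoring an extension of `f` through finitely many weighted derivatives shows
that `φ_k * f` is continuous, has polynomial growth and is reproduced by convolution with a rescaled
Schwartz function (`exists_reproducing_kernel`). Boundedness then comes from a supremum with a
polynomial weight. -/

theorem exists_one_add_pow_mul_iteratedFDeriv_le (h : 𝓢(E n, ℂ)) (N m : ℕ) :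
    ∃ C : ℝ, 0 ≤ C ∧ ∀ x, (1 + ‖x‖) ^ N * ‖iteratedFDeriv ℝ m h x‖ ≤ C :=
  ⟨_, by positivity, fun x =>
    one_add_le_sup_seminorm_apply (𝕜 := ℝ) (m := (N, m)) le_rfl le_rfl h x⟩

theorem one_add_norm_pow_le (N : ℕ) (x y : E n) :
    (1 + ‖x‖) ^ N ≤ (1 + ‖x - y‖) ^ N * (1 + ‖y‖) ^ N := by
  rw [← mul_pow]
  have h1 : ‖x‖ ≤ ‖x - y‖ + ‖y‖ := by simpa using norm_add_le (x - y) y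
  have h2 : 0 ≤ ‖x - y‖ * ‖y‖ := by positivity
  gcongr
  linarith

/-- The bounded continuous functions with values in the continuous `m`-linear forms. -/
def JetFiber (n m : ℕ) : Type := BoundedContinuousFunction (E n) (E n [×m]→L[ℝ] ℂ)

noncomputable instance (n m : ℕ) : NormedAddCommGroup (JetFiber n m) :=
  inferInstanceAs (NormedAddCommGroup (BoundedContinuousFunction (E n) (E n [×m]→L[ℝ] ℂ)))

noncomputable instance (n m : ℕ) : NormedSpace ℂ (JetFiber n m) :=
  inferInstanceAs (NormedSpace ℂ (BoundedContinuousFunction (E n) (E n [×m]→L[ℝ] ℂ)))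

instance (n m : ℕ) : CompleteSpace (JetFiber n m) :=
  inferInstanceAs (CompleteSpace (BoundedContinuousFunction (E n) (E n [×m]→L[ℝ] ℂ)))

/-- The space of tuples of bounded continuous functions that contains the weighted derivatives of
order at most `M` of a function. -/
abbrev JetSpace (n M : ℕ) : Type := (m : Fin (M + 1)) → JetFiber n m

/-- Evaluation at a point on `JetFiber n m`. -/
noncomputable def JetFiber.eval {n m : ℕ} (x : E n) : JetFiber n m →L[ℂ] (E n [×m]→L[ℝ] ℂ) :=
  BoundedContinuousFunction.evalCLM ℂ x

theorem JetFiber.norm_le {n m : ℕ} {F : JetFiber n m} {C : ℝ} (hC : 0 ≤ C) :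
    ‖F‖ ≤ C ↔ ∀ x, ‖JetFiber.eval x F‖ ≤ C :=
  BoundedContinuousFunction.norm_le (f := F) hC

theorem JetFiber.ext {n m : ℕ} {F G : JetFiber n m}
    (h : ∀ x, JetFiber.eval x F = JetFiber.eval x G) : F = G :=
  BoundedContinuousFunction.ext h

/-- The `m`-th derivative of a Schwartz function, multiplied by `(1 + ‖x‖) ^ N`, as a bounded
continuous function. -/
noncomputable def weightedDeriv (n N m : ℕ) :
    𝓢(E n, ℂ) →ₗ[ℂ] JetFiber n m where
  toFun h := BoundedContinuousFunction.ofNormedAddCommGroup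
    (fun x => ((1 + ‖x‖) ^ N : ℝ) • iteratedFDeriv ℝ m h x)
    (((continuous_const.add continuous_norm).pow N).smul
      ((h.smooth m).continuous_iteratedFDeriv le_rfl))
    (exists_one_add_pow_mul_iteratedFDeriv_le h N m).choose
    (fun x => by
      rw [norm_smul, Real.norm_of_nonneg (by positivity)]
      exact (exists_one_add_pow_mul_iteratedFDeriv_le h N m).choose_spec.2 x)
  map_add' f g := by
    refine JetFiber.ext fun x => ?_
    change ((1 + ‖x‖) ^ N : ℝ) • iteratedFDeriv ℝ m (f + g : E n → ℂ) x =
      ((1 + ‖x‖) ^ N : ℝ) • iteratedFDeriv ℝ m f x + ((1 + ‖x‖) ^ N : ℝ) • iteratedFDeriv ℝ m g x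
    rw [iteratedFDeriv_add_apply (f.smooth m).contDiffAt (g.smooth m).contDiffAt, smul_add]
  map_smul' c f := by
    refine JetFiber.ext fun x => ?_
    change ((1 + ‖x‖) ^ N : ℝ) • iteratedFDeriv ℝ m (c • f : E n → ℂ) x =
      c • ((1 + ‖x‖) ^ N : ℝ) • iteratedFDeriv ℝ m f x
    rw [iteratedFDeriv_const_smul_apply (f.smooth m).contDiffAt, smul_comm]

/-- All the weighted derivatives of order at most `M` of a Schwartz function. -/
noncomputable def jet (n N M : ℕ) :
    𝓢(E n, ℂ) →ₗ[ℂ] JetSpace n M :=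
  LinearMap.pi fun m => weightedDeriv n N m

theorem jet_apply (N M : ℕ) (h : 𝓢(E n, ℂ)) (m : Fin (M + 1)) (x : E n) :
    JetFiber.eval x (jet n N M h m) = ((1 + ‖x‖) ^ N : ℝ) • iteratedFDeriv ℝ m h x := rfl

theorem seminorm_le_norm_jet {N M k m : ℕ} (hk : k ≤ N) (hm : m ≤ M) (h : 𝓢(E n, ℂ)) :
    SchwartzMap.seminorm ℂ k m h ≤ ‖jet n N M h‖ := by
  refine seminorm_le_bound ℂ k m h (norm_nonneg _) fun x => ?_
  have h1 : ‖JetFiber.eval x (jet n N M h ⟨m, Nat.lt_succ_of_le hm⟩)‖ ≤ ‖jet n N M h‖ :=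
    (JetFiber.norm_le (norm_nonneg _)).1 (norm_le_pi_norm (jet n N M h) ⟨m, Nat.lt_succ_of_le hm⟩) x
  refine le_trans ?_ h1
  rw [jet_apply, norm_smul, Real.norm_of_nonneg (by positivity)]
  refine mul_le_mul_of_nonneg_right ?_ (norm_nonneg _)
  calc ‖x‖ ^ k ≤ (1 + ‖x‖) ^ k := by gcongr; linarith
    _ ≤ (1 + ‖x‖) ^ N := pow_le_pow_right₀ (by linarith [norm_nonneg x]) hk

theorem jet_injective (N M : ℕ) : Function.Injective (jet n N M) := by
  refine (injective_iff_map_eq_zero _).2 fun h hh => ?_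
  ext x
  have h1 : ‖h x‖ ≤ 0 := by
    calc ‖h x‖ ≤ SchwartzMap.seminorm ℂ 0 0 h := norm_le_seminorm ℂ h x
      _ ≤ ‖jet n N M h‖ := seminorm_le_norm_jet (Nat.zero_le _) (Nat.zero_le _) h
      _ = 0 := by rw [hh, norm_zero]
  simpa using h1

/-- A tempered distribution factors through finitely many weighted derivatives. -/
theorem exists_comp_jet (T : 𝓢(E n, ℂ) →L[ℂ] ℂ) :
    ∃ (N M : ℕ) (L : JetSpace n M
  →L[ℂ] ℂ), ∀ h, T h = L (jet n N M h) := by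
  obtain ⟨S, C, -, hC⟩ := Seminorm.bound_of_continuous (schwartz_withSeminorms ℂ (E n) ℂ)
    ((normSeminorm ℂ ℂ).comp T.toLinearMap) (continuous_norm.comp T.continuous)
  obtain ⟨⟨N, M⟩, hNM⟩ := S.bddAbove
  have hb (h : 𝓢(E n, ℂ)) : ‖T h‖ ≤ C * ‖jet n N M h‖ := by
    refine (hC h).trans ?_
    rw [smul_apply, NNReal.smul_def, smul_eq_mul]
    refine mul_le_mul_of_nonneg_left ?_ C.2
    refine Seminorm.finset_sup_apply_le (norm_nonneg _) fun i hi => ?_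
    exact seminorm_le_norm_jet (hNM hi).1 (hNM hi).2 h
  -- By injectivity `T` is a functional on the range of `jet`, bounded there by `hb`; Hahn–Banach
  -- extends it to the whole Banach space.
  let e := LinearEquiv.ofInjective (jet n N M) (jet_injective N M)
  let f : LinearMap.range (jet n N M) →L[ℂ] ℂ :=
    (T.toLinearMap.comp e.symm.toLinearMap).mkContinuous C (fun y => by
      obtain ⟨h, rfl⟩ := e.surjective y
      simpa [e] using hb h)
  obtain ⟨L, hL, -⟩ := exists_extension_norm_eq _ f
  refine ⟨N, M, L, fun h => ?_⟩
  have := hL (e h)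
  simpa [f, e] using this.symm

theorem iteratedFDeriv_compSubConstCLM (h : 𝓢(E n, ℂ)) (m : ℕ) (y x : E n) :
    iteratedFDeriv ℝ m (compSubConstCLM ℂ y h) x = iteratedFDeriv ℝ m h (x - y) :=
  iteratedFDeriv_comp_sub m y x

theorem exists_norm_jet_compSubConstCLM_le (N M : ℕ) (h : 𝓢(E n, ℂ)) :
    ∃ C : ℝ, 0 ≤ C ∧ ∀ y, ‖jet n N M (compSubConstCLM ℂ y h)‖ ≤ C * (1 + ‖y‖) ^ N := by
  choose C hC0 hC using exists_one_add_pow_mul_iteratedFDeriv_le h N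
  refine ⟨∑ m : Fin (M + 1), C m, Finset.sum_nonneg fun m _ => hC0 m, fun y => ?_⟩
  have h0 : 0 ≤ ∑ m : Fin (M + 1), C m := Finset.sum_nonneg fun m _ => hC0 m
  refine (pi_norm_le_iff_of_nonneg (by positivity)).2 fun m => ?_
  refine (JetFiber.norm_le (by positivity)).2 fun x => ?_
  rw [jet_apply, iteratedFDeriv_compSubConstCLM, norm_smul, Real.norm_of_nonneg (by positivity)]
  calc (1 + ‖x‖) ^ N * ‖iteratedFDeriv ℝ m h (x - y)‖
      ≤ (1 + ‖x - y‖) ^ N * (1 + ‖y‖) ^ N * ‖iteratedFDeriv ℝ m h (x - y)‖ := by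
        gcongr; exact one_add_norm_pow_le N x y
    _ = (1 + ‖x - y‖) ^ N * ‖iteratedFDeriv ℝ m h (x - y)‖ * (1 + ‖y‖) ^ N := by ring
    _ ≤ C m * (1 + ‖y‖) ^ N := by gcongr; exact hC m _
    _ ≤ _ := by
      gcongr
      exact Finset.single_le_sum (f := fun m : Fin (M + 1) => C m) (fun m _ => hC0 m)
        (Finset.mem_univ m)

theorem hasFDerivAt_iteratedFDeriv (h : 𝓢(E n, ℂ)) (m : ℕ) (x : E n) :
    HasFDerivAt (iteratedFDeriv ℝ m h) (fderiv ℝ (iteratedFDeriv ℝ m h) x) x :=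
  ((h.smooth (m + 1)).differentiable_iteratedFDeriv
    (by exact_mod_cast Nat.lt_succ_self m) x).hasFDerivAt

/-- The mean value inequality on the unit ball around `x - y₀` controls the difference by the next
derivative. Moving the weight from `x` to a point of that ball costs at most `(2 + ‖y₀‖) ^ N`,
uniformly in `x`. -/
theorem continuous_jet_compSubConstCLM (N M : ℕ) (h : 𝓢(E n, ℂ)) :
    Continuous fun y => jet n N M (compSubConstCLM ℂ y h) := by
  refine continuous_pi fun m => continuous_iff_continuousAt.2 fun y₀ => ?_
  obtain ⟨C, hC0, hC⟩ := exists_one_add_pow_mul_iteratedFDeriv_le h N (m + 1)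
  set K : ℝ := C * (2 + ‖y₀‖) ^ N with hK
  have hK0 : 0 ≤ K := by positivity
  refine continuousAt_of_locally_lipschitz one_pos K fun y hy => ?_
  refine (dist_eq_norm _ _).trans_le ((JetFiber.norm_le (by positivity)).2 fun x => ?_)
  have hsub : ((1 + ‖x‖) ^ N : ℝ) • iteratedFDeriv ℝ m h (x - y)
      - ((1 + ‖x‖) ^ N : ℝ) • iteratedFDeriv ℝ m h (x - y₀)
      = ((1 + ‖x‖) ^ N : ℝ) • (iteratedFDeriv ℝ m h (x - y) - iteratedFDeriv ℝ m h (x - y₀)) := by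
    ext v
    simp [mul_sub]
  rw [map_sub, jet_apply, jet_apply, iteratedFDeriv_compSubConstCLM,
    iteratedFDeriv_compSubConstCLM, hsub, norm_smul, Real.norm_of_nonneg (by positivity)]
  have hW : 0 < (1 + ‖x‖) ^ N := by positivity
  have key : ‖iteratedFDeriv ℝ m h (x - y) - iteratedFDeriv ℝ m h (x - y₀)‖
      ≤ K / (1 + ‖x‖) ^ N * ‖(x - y) - (x - y₀)‖ := by
    refine (convex_closedBall (x - y₀) 1).norm_image_sub_le_of_norm_hasFDerivWithin_le
      (fun z _ => (hasFDerivAt_iteratedFDeriv h m z).hasFDerivWithinAt) (fun z hz => ?_)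
      (Metric.mem_closedBall_self zero_le_one) ?_
    · rw [norm_fderiv_iteratedFDeriv, le_div_iff₀ hW]
      have hz' : ‖x - z‖ ≤ 1 + ‖y₀‖ := by
        have h1 : x - z = y₀ - (z - (x - y₀)) := by abel
        rw [Metric.mem_closedBall, dist_eq_norm] at hz
        rw [h1]
        linarith [norm_sub_le y₀ (z - (x - y₀))]
      calc ‖iteratedFDeriv ℝ (m + 1) h z‖ * (1 + ‖x‖) ^ N
          ≤ ‖iteratedFDeriv ℝ (m + 1) h z‖ * ((1 + ‖x - (x - z)‖) ^ N * (1 + ‖x - z‖) ^ N) := by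
            gcongr; exact one_add_norm_pow_le N x (x - z)
        _ = (1 + ‖z‖) ^ N * ‖iteratedFDeriv ℝ (m + 1) h z‖ * (1 + ‖x - z‖) ^ N := by
            rw [sub_sub_cancel]; ring
        _ ≤ C * (2 + ‖y₀‖) ^ N := by
            refine mul_le_mul (hC z) (pow_le_pow_left₀ (by positivity) (by linarith) N) (by positivity) hC0
    · rw [Metric.mem_closedBall, dist_eq_norm, sub_sub_sub_cancel_left, norm_sub_rev,
        ← dist_eq_norm]
      exact hy.le
  rw [sub_sub_sub_cancel_left y y₀ x, norm_sub_rev y₀ y, ← dist_eq_norm y y₀] at key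
  calc _ ≤ (1 + ‖x‖) ^ N * (K / (1 + ‖x‖) ^ N * dist y y₀) := by gcongr
    _ = K * dist y y₀ := by field_simp

theorem exists_norm_apply_compSubConstCLM_le (T : 𝓢(E n, ℂ) →L[ℂ] ℂ) (h : 𝓢(E n, ℂ)) :
    ∃ (C : ℝ) (N : ℕ), 0 ≤ C ∧ ∀ y, ‖T (compSubConstCLM ℂ y h)‖ ≤ C * (1 + ‖y‖) ^ N := by
  obtain ⟨N, M, L, hL⟩ := exists_comp_jet T
  obtain ⟨C, hC0, hC⟩ := exists_norm_jet_compSubConstCLM_le N M h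
  refine ⟨‖L‖ * C, N, by positivity, fun y => ?_⟩
  rw [hL, mul_assoc]
  exact (L.le_opNorm _).trans (by gcongr; exact hC y)

theorem continuous_apply_compSubConstCLM (T : 𝓢(E n, ℂ) →L[ℂ] ℂ) (h : 𝓢(E n, ℂ)) :
    Continuous fun y => T (compSubConstCLM ℂ y h) := by
  obtain ⟨N, M, L, hL⟩ := exists_comp_jet T
  simp_rw [hL]
  exact L.continuous.comp (continuous_jet_compSubConstCLM N M h)

theorem fderiv_eq_integral {ψ : 𝓢(E n, ℂ)} {k : E n → ℂ} (hk : ContDiff ℝ 1 k) {C D : ℝ}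
    (hC : ∀ w, ‖k w‖ ≤ C) (hD : ∀ w, ‖fderiv ℝ k w‖ ≤ D)
    (hψ : ∀ w, k w = ∫ y, ψ y * k (w + y)) (w a : E n) :
    fderiv ℝ k w a = ∫ y, ψ y * fderiv ℝ k (w + y) a := by
  have hcont : Continuous (fderiv ℝ k) := hk.continuous_fderiv one_ne_zero
  have hmeas (w : E n) : AEStronglyMeasurable (fun y => ψ y * k (w + y)) volume :=
    (ψ.continuous.mul (hk.continuous.comp (continuous_const.add continuous_id))).aestronglyMeasurable
  have hmeas' : AEStronglyMeasurable (fun y => ψ y • fderiv ℝ k (w + y)) volume :=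
    (ψ.continuous.smul (hcont.comp (continuous_const.add continuous_id))).aestronglyMeasurable
  have hint' : Integrable (fun y => ψ y • fderiv ℝ k (w + y)) :=
    (ψ.integrable.norm.mul_const D).mono' hmeas' (Filter.Eventually.of_forall fun y => by
      rw [norm_smul]; gcongr; exact hD _)
  have hd : HasFDerivAt (fun w => ∫ y, ψ y * k (w + y)) (∫ y, ψ y • fderiv ℝ k (w + y)) w := by
    refine hasFDerivAt_integral_of_dominated_of_fderiv_le (bound := fun y => ‖ψ y‖ * D)
      (F' := fun w y => ψ y • fderiv ℝ k (w + y)) Filter.univ_mem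
      (Filter.Eventually.of_forall hmeas) ?_ hmeas'
      (Filter.Eventually.of_forall fun y w _ => ?_) (ψ.integrable.norm.mul_const D)
      (Filter.Eventually.of_forall fun y w _ => ?_)
    · exact (ψ.integrable.norm.mul_const C).mono' (hmeas w) (Filter.Eventually.of_forall fun y => by
        rw [norm_mul]; gcongr; exact hC _)
    · rw [norm_smul]; gcongr; exact hD _
    · have h1 : HasFDerivAt k (fderiv ℝ k (w + y)) (w + y) :=
        (hk.differentiable one_ne_zero _).hasFDerivAt
      have h2 : HasFDerivAt (fun w => k (w + y)) (fderiv ℝ k (w + y)) w :=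
        (hasFDerivAt_comp_add_right y).2 h1
      exact h2.const_mul (ψ y)
  have heq : fderiv ℝ k w = ∫ y, ψ y • fderiv ℝ k (w + y) := by
    refine HasFDerivAt.unique ?_ hd
    rw [← funext hψ]
    exact (hk.differentiable one_ne_zero _).hasFDerivAt
  rw [heq, ContinuousLinearMap.integral_apply hint']
  rfl

/-- Differentiation under the integral sign, one direction at a time: the induction step applies
`fderiv_eq_integral` to the `m`-th derivative evaluated at the tail of `v`, in the direction `v 0`.
-/
theorem iteratedFDeriv_eq_integral {ψ h : 𝓢(E n, ℂ)} (hψ : ∀ w, h w = ∫ y, ψ y * h (w + y))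
    (m : ℕ) (w : E n) (v : Fin m → E n) :
    iteratedFDeriv ℝ m h w v = ∫ y, ψ y * iteratedFDeriv ℝ m h (w + y) v := by
  induction m generalizing w with
  | zero => simpa using hψ w
  | succ m ih =>
    obtain ⟨C, -, hC⟩ := exists_one_add_pow_mul_iteratedFDeriv_le h 0 m
    obtain ⟨D, -, hD⟩ := exists_one_add_pow_mul_iteratedFDeriv_le h 0 (m + 1)
    let ev := ContinuousMultilinearMap.apply ℝ (fun _ : Fin m => E n) ℂ (Fin.tail v)
    have hk : ContDiff ℝ 1 fun z => ev (iteratedFDeriv ℝ m h z) :=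
      ev.contDiff.comp ((h.smooth ((m + 1 : ℕ) : ℕ∞)).iteratedFDeriv_right
        (by rw [add_comm]; exact_mod_cast le_rfl))
    have hf (z : E n) : fderiv ℝ (fun z => ev (iteratedFDeriv ℝ m h z)) z
        = ev.comp (fderiv ℝ (iteratedFDeriv ℝ m h) z) :=
      (ev.hasFDerivAt.comp z (hasFDerivAt_iteratedFDeriv h m z)).fderiv
    have key := fderiv_eq_integral (ψ := ψ) hk (C := ‖ev‖ * C) (D := ‖ev‖ * D)
      (fun z => (ev.le_opNorm _).trans (by gcongr; simpa using hC z))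
      (fun z => by
        rw [hf]
        refine (ContinuousLinearMap.opNorm_comp_le _ _).trans ?_
        rw [norm_fderiv_iteratedFDeriv]
        gcongr
        simpa using hD z) (fun z => ih z (Fin.tail v)) w (v 0)
    simp_rw [hf] at key
    exact key

/-- The evaluation of multilinear forms at a vector, as a `ℂ`-linear map. -/
noncomputable def evalVec {m : ℕ} (v : Fin m → E n) : (E n [×m]→L[ℝ] ℂ) →L[ℂ] ℂ :=
  LinearMap.mkContinuous
    { toFun := fun c => c v
      map_add' := fun _ _ => rfl
      map_smul' := fun _ _ => rfl } (∏ i, ‖v i‖)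
    (fun c => (c.le_opNorm v).trans_eq (mul_comm _ _))

/-- A convolution identity for a Schwartz function passes to its translates under a tempered
distribution. -/
theorem apply_compSubConstCLM_eq_integral (T : 𝓢(E n, ℂ) →L[ℂ] ℂ) {ψ h : 𝓢(E n, ℂ)}
    (hψ : ∀ w, h w = ∫ y, ψ y * h (w + y)) (x : E n) :
    T (compSubConstCLM ℂ x h) = ∫ y, ψ y * T (compSubConstCLM ℂ (x - y) h) := by
  obtain ⟨N, M, L, hL⟩ := exists_comp_jet T
  have hint : Integrable fun y => ψ y • jet n N M (compSubConstCLM ℂ (x - y) h) := by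
    obtain ⟨C, hC0, hC⟩ := exists_norm_jet_compSubConstCLM_le N M h
    have hcont : Continuous fun y => jet n N M (compSubConstCLM ℂ (x - y) h) :=
      (continuous_jet_compSubConstCLM N M h).comp (continuous_const.sub continuous_id)
    have hd : Integrable fun y : E n => C * (1 + ‖x‖) ^ N * ((1 + ‖y‖) ^ N * ‖ψ y‖) := by
      refine Integrable.const_mul ?_ _
      have hexp : (fun y : E n => (1 + ‖y‖) ^ N * ‖ψ y‖)
          = fun y => ∑ i ∈ Finset.range (N + 1), (N.choose i : ℝ) * (‖y‖ ^ i * ‖ψ y‖) := by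
        funext y
        rw [add_comm, add_pow, Finset.sum_mul]
        exact Finset.sum_congr rfl fun i _ => by ring
      rw [hexp]
      exact integrable_finsetSum _ fun i _ => (ψ.integrable_pow_mul volume i).const_mul _
    refine hd.mono' (ψ.continuous.smul hcont).aestronglyMeasurable
      (Filter.Eventually.of_forall fun y => ?_)
    rw [norm_smul]
    calc ‖ψ y‖ * ‖jet n N M (compSubConstCLM ℂ (x - y) h)‖
        ≤ ‖ψ y‖ * (C * ((1 + ‖x‖) ^ N * (1 + ‖y‖) ^ N)) := by
          gcongr
          refine (hC _).trans ?_
          rw [← mul_pow]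
          gcongr
          nlinarith [norm_sub_le x y, mul_nonneg (norm_nonneg x) (norm_nonneg y)]
      _ = _ := by ring
  -- The right side is a Bochner integral in a Banach space. The functionals `Λ` (a derivative at a
  -- point, along given vectors) commute with it and separate points, which reduces the identity to
  -- `iteratedFDeriv_eq_integral`.
  have hjet : jet n N M (compSubConstCLM ℂ x h)
      = ∫ y, ψ y • jet n N M (compSubConstCLM ℂ (x - y) h) := by
    funext m
    refine JetFiber.ext fun z => ContinuousMultilinearMap.ext fun v => ?_
    let Λ : JetSpace n M →L[ℂ] ℂ :=
      (evalVec v).comp ((JetFiber.eval z).comp (ContinuousLinearMap.proj m))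
    have hΛ (t : E n) : Λ (jet n N M (compSubConstCLM ℂ t h))
        = ((1 + ‖z‖) ^ N : ℝ) * iteratedFDeriv ℝ m h (z - t) v := by
      change JetFiber.eval z (jet n N M (compSubConstCLM ℂ t h) m) v = _
      rw [jet_apply, iteratedFDeriv_compSubConstCLM]
      simp
    have h1 : Λ (jet n N M (compSubConstCLM ℂ x h))
        = Λ (∫ y, ψ y • jet n N M (compSubConstCLM ℂ (x - y) h)) := by
      rw [← Λ.integral_comp_comm hint, hΛ, iteratedFDeriv_eq_integral hψ, ← integral_const_mul]
      refine integral_congr_ae (Filter.Eventually.of_forall fun y => ?_)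
      simp only [map_smul, hΛ, smul_eq_mul, sub_sub_eq_add_sub, sub_add_eq_add_sub]
      ring
    exact h1
  simp_rw [hL]
  rw [hjet, ← L.integral_comp_comm hint]
  simp

end Schwartz

/-! ### The blocks `φ_k * f`: regularity and the reproducing formula -/

section Reproducing

variable {n : ℕ}

theorem exists_fourier_eq_one (n : ℕ) :
    ∃ ψ : 𝓢(E n, ℂ), ∀ η : E n, ‖η‖ ≤ 2 → 𝓕 (ψ : E n → ℂ) η = 1 := by
  let b : ContDiffBump (0 : E n) := ⟨2, 3, by norm_num, by norm_num⟩
  have hb : HasCompactSupport fun x => (b x : ℂ) :=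
    b.hasCompactSupport.comp_left (g := Complex.ofReal) Complex.ofReal_zero
  have hs : ContDiff ℝ (⊤ : ℕ∞) fun x => (b x : ℂ) :=
    Complex.ofRealCLM.contDiff.comp b.contDiff
  refine ⟨𝓕⁻ (hb.toSchwartzMap hs), fun η hη => ?_⟩
  rw [← SchwartzMap.fourier_coe, FourierTransform.fourier_fourierInv_eq]
  change (b η : ℂ) = 1
  rw [b.one_of_mem_closedBall (by simpa using hη), Complex.ofReal_one]

/-- The function `x ↦ cⁿ ψ(c x)`. -/
noncomputable def rescale (ψ : 𝓢(E n, ℂ)) (c : ℝ) (hc : c ≠ 0) : 𝓢(E n, ℂ) :=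
  ((c ^ n : ℝ) : ℂ) • compCLMOfContinuousLinearEquiv ℂ (dilation n c hc) ψ

theorem rescale_apply (ψ : 𝓢(E n, ℂ)) (c : ℝ) (hc : c ≠ 0) (x : E n) :
    rescale ψ c hc x = ((c ^ n : ℝ) : ℂ) * ψ (c • x) := rfl

theorem fourier_rescale (ψ : 𝓢(E n, ℂ)) (c : ℝ) (hc : 0 < c) (η : E n) :
    𝓕 (rescale ψ c hc.ne' : E n → ℂ) η = 𝓕 (ψ : E n → ℂ) (c⁻¹ • η) := by
  rw [Real.fourier_eq', Real.fourier_eq']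
  have h1 := Measure.integral_comp_smul (volume : Measure (E n))
    (fun y => Complex.exp (((-2 * Real.pi * inner ℝ y (c⁻¹ • η) : ℝ) : ℂ) * Complex.I) • ψ y) c
  rw [finrank_euclideanSpace_fin, abs_of_pos (by positivity)] at h1
  have h2 : (c ^ n : ℝ) • ((c ^ n)⁻¹ : ℝ) • (∫ y, Complex.exp (((-2 * Real.pi *
      inner ℝ y (c⁻¹ • η) : ℝ) : ℂ) * Complex.I) • ψ y) = ∫ y, Complex.exp (((-2 * Real.pi *
      inner ℝ y (c⁻¹ • η) : ℝ) : ℂ) * Complex.I) • ψ y := by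
    rw [smul_smul, mul_inv_cancel₀ (by positivity), one_smul]
  rw [← h2, ← h1, ← integral_smul]
  refine integral_congr_ae (Filter.Eventually.of_forall fun y => ?_)
  simp only [rescale_apply, smul_eq_mul, Complex.real_smul, inner_smul_left, inner_smul_right]
  rw [conj_trivial, inv_mul_cancel_left₀ hc.ne']
  ring

/-- On the Fourier side the hypothesis says that convolution with `ψ` fixes `h`; Fourier inversion
does the rest. -/
theorem eq_integral_of_fourier_mul_eq {ψ h : 𝓢(E n, ℂ)}
    (H : ∀ η, 𝓕 (ψ : E n → ℂ) η * 𝓕 (h : E n → ℂ) η = 𝓕 (h : E n → ℂ) η) (w : E n) :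
    h w = ∫ y, ψ y * h (w - y) := by
  have h1 : SchwartzMap.convolution (ContinuousLinearMap.mul ℂ ℂ) ψ h = h := by
    have h2 : 𝓕 (SchwartzMap.convolution (ContinuousLinearMap.mul ℂ ℂ) ψ h) = 𝓕 h := by
      rw [fourier_convolution]
      ext η
      rw [pairing_apply_apply, fourier_coe, fourier_coe]
      exact H η
    have h3 := congrArg (fun g : 𝓢(E n, ℂ) => (𝓕⁻ g : 𝓢(E n, ℂ))) h2
    simpa only [FourierTransform.fourierInv_fourier_eq] using h3
  conv_lhs => rw [← h1]
  rw [SchwartzMap.convolution_apply]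
  rfl

/-- Hahn–Banach in a locally convex space. The extension is not unique, but `φ_k * f` only tests it
on elements of `dotSchwartz n`. -/
theorem DotDistribution.exists_extension (f : DotDistribution n) :
    ∃ T : 𝓢(E n, ℂ) →L[ℂ] ℂ, ∀ h : dotSchwartz n, T h = f h :=
  haveI : PolynormableSpace ℂ 𝓢(E n, ℂ) :=
    (schwartz_withSeminorms ℂ (E n) ℂ).toPolynormableSpace
  StrongDual.exists_extension (dotSchwartz n) f

theorem DyadicPartition.conv_eq_apply (P : DyadicPartition n) (k : ℤ) {f : DotDistribution n}
    {T : 𝓢(E n, ℂ) →L[ℂ] ℂ} (hT : ∀ h : dotSchwartz n, T h = f h) (x : E n) :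
    P.conv k f x = T (compSubConstCLM ℂ x
      (compCLMOfContinuousLinearEquiv ℂ (ContinuousLinearEquiv.neg ℝ) (P.kernel k))) :=
  (hT _).symm

theorem DyadicPartition.continuous_conv (P : DyadicPartition n) (k : ℤ) (f : DotDistribution n) :
    Continuous (P.conv k f) := by
  obtain ⟨T, hT⟩ := DotDistribution.exists_extension f
  simp_rw [funext (P.conv_eq_apply k hT)]
  exact continuous_apply_compSubConstCLM T _

theorem DyadicPartition.exists_norm_conv_le (P : DyadicPartition n) (k : ℤ)
    (f : DotDistribution n) :
    ∃ (C : ℝ) (N : ℕ), 0 ≤ C ∧ ∀ x, ‖P.conv k f x‖ ≤ C * (1 + ‖x‖) ^ N := by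
  obtain ⟨T, hT⟩ := DotDistribution.exists_extension f
  simp_rw [P.conv_eq_apply k hT]
  exact exists_norm_apply_compSubConstCLM_le T _

/-- The functions `φ_k * f` are reproduced by the dilations of one Schwartz function. -/
theorem exists_reproducing_kernel (n : ℕ) : ∃ ψ : 𝓢(E n, ℂ), ∀ (P : DyadicPartition n) (k : ℤ)
    (f : DotDistribution n) (x : E n), P.conv k f x =
      ∫ y, rescale ψ ((2 : ℝ) ^ k) (zpow_ne_zero k two_ne_zero) y * P.conv k f (x - y) := by
  obtain ⟨ψ, hψ⟩ := exists_fourier_eq_one n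
  refine ⟨ψ, fun P k f x => ?_⟩
  obtain ⟨T, hT⟩ := DotDistribution.exists_extension f
  simp_rw [P.conv_eq_apply k hT]
  refine apply_compSubConstCLM_eq_integral T (fun w => ?_) x
  -- The function being translated is the reflected kernel, hence `w + y` in place of the `w - y` of
  -- a convolution.
  change P.kernel k (-w) = ∫ y, _ * P.kernel k (-(w + y))
  rw [eq_integral_of_fourier_mul_eq (ψ := rescale ψ ((2 : ℝ) ^ k) (zpow_ne_zero k two_ne_zero))]
  · simp_rw [neg_add, sub_eq_add_neg]
  · intro η
    by_cases hη : P.φ (((2 : ℝ) ^ (-k) * (2 * Real.pi)) • η) = 0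
    · rw [P.fourier_kernel, hη, mul_zero]
    · have h2 := (P.support_subset hη).2
      rw [fourier_rescale ψ _ (by positivity), hψ, one_mul]
      rw [norm_smul, Real.norm_of_nonneg (by positivity)] at h2 ⊢
      -- On the support of the transform of the kernel `2^{-k} · 2π ‖η‖ ≤ 2`. Since `2π ≥ 1`, the
      -- point `2^{-k} η` lies in the ball of radius `2`, where the transform of `ψ` is `1`.
      rw [← zpow_neg]
      refine le_trans ?_ h2
      gcongr
      refine le_mul_of_one_le_right (by positivity) ?_
      linarith [Real.two_le_pi]

end Reproducing

/-! ### Nikolskii's inequality for all `0 < q < p < ∞` -/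

section Nikolskii

variable {n : ℕ}

theorem rpow_le_of_le_rpow_mul {S a : ℝ≥0∞} {q : ℝ} (hq : 0 < q) (hS : S ≠ ∞)
    (h : S ≤ S ^ (1 - q) * a) : S ^ q ≤ a := by
  rcases eq_or_ne S 0 with rfl | hS0
  · rw [ENNReal.zero_rpow_of_pos hq]; exact zero_le
  · have h1 : S ^ (q - 1) * S ≤ S ^ (q - 1) * (S ^ (1 - q) * a) := by gcongr
    rw [← mul_assoc, ← ENNReal.rpow_add _ _ hS0 hS] at h1
    nth_rewrite 2 [← ENNReal.rpow_one S] at h1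
    rw [← ENNReal.rpow_add _ _ hS0 hS] at h1
    simpa using h1

/-- The weight `(1 + ‖x‖) ^ N` with values in `[0, ∞]`. -/
noncomputable def growth (N : ℕ) (x : E n) : ℝ≥0∞ := ENNReal.ofReal ((1 + ‖x‖) ^ N)

theorem one_le_growth (N : ℕ) (x : E n) : 1 ≤ growth N x := by
  rw [growth, ENNReal.one_le_ofReal]
  exact one_le_pow₀ (by linarith [norm_nonneg x])

theorem growth_ne_top (N : ℕ) (x : E n) : growth N x ≠ ∞ := ENNReal.ofReal_ne_top

theorem growth_le (N : ℕ) (x y z : E n) :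
    growth N (x - z) ≤ growth N (x - y) * growth N (y - z) := by
  rw [growth, growth, growth, ← ENNReal.ofReal_mul (by positivity)]
  refine ENNReal.ofReal_le_ofReal ?_
  have := one_add_norm_pow_le N (x - z) (y - z)
  rwa [sub_sub_sub_cancel_right] at this

theorem growth_neg (N : ℕ) (x : E n) : growth N (-x) = growth N x := by
  rw [growth, growth, norm_neg]

/-- For `q ≤ 1` write `G = G^{1-q} G^q` and estimate the first factor by a supremum `S`, which leads
to `S ≤ S^{1-q} κ ∫ G^q`. Dividing by `S^{1-q}` requires `S < ∞`; this is why `S` is taken with a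
polynomial weight that dominates the growth of `G`. Centring the weight at `x₀` makes it equal to
`1` there. -/
theorem rpow_le_of_le_lintegral_of_growth {q : ℝ} (hq : 0 < q) (hq1 : q ≤ 1) {G K : E n → ℝ≥0∞}
    {N : ℕ} {C κ : ℝ≥0∞} (hC : C ≠ ∞) (hG : ∀ x, G x ≤ C * growth N x)
    (hK : ∀ x, K x * growth N x ≤ κ) (h : ∀ x, G x ≤ ∫⁻ z, K (x - z) * G z)
    (hGm : Measurable G) (x₀ : E n) : G x₀ ^ q ≤ κ * ∫⁻ z, G z ^ q := by
  set S : ℝ≥0∞ := ⨆ z, G z / growth N (z - x₀) with hS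
  have hpos (z : E n) : growth N z ≠ 0 := (one_pos.trans_le (one_le_growth N z)).ne'
  have hGS (z : E n) : G z ≤ S * growth N (z - x₀) := by
    rw [← ENNReal.div_le_iff (hpos _) (growth_ne_top _ _)]
    exact le_iSup (fun z => G z / growth N (z - x₀)) z
  have hStop : S ≠ ∞ := by
    refine ne_top_of_le_ne_top (ENNReal.mul_ne_top hC (growth_ne_top N x₀)) (iSup_le fun z => ?_)
    rw [ENNReal.div_le_iff (hpos _) (growth_ne_top _ _), mul_assoc, mul_comm (growth N x₀)]
    refine (hG z).trans ?_
    gcongr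
    simpa using growth_le N z x₀ 0
  have hmain (x : E n) : G x ≤ S ^ (1 - q) * (κ * ∫⁻ z, G z ^ q) * growth N (x - x₀) := by
    calc G x ≤ ∫⁻ z, K (x - z) * G z := h x
      _ ≤ ∫⁻ z, (S ^ (1 - q) * κ * growth N (x - x₀)) * G z ^ q := by
        refine lintegral_mono fun z => ?_
        have h1 : G z = G z ^ (1 - q) * G z ^ q := by
          rw [← ENNReal.rpow_add_of_nonneg _ _ (by linarith) hq.le]; simp
        have h2 : G z ^ (1 - q) ≤ S ^ (1 - q) * (growth N (x - z) * growth N (x - x₀)) := by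
          calc G z ^ (1 - q) ≤ (S * growth N (z - x₀)) ^ (1 - q) :=
                ENNReal.rpow_le_rpow (hGS z) (by linarith)
            _ = S ^ (1 - q) * growth N (z - x₀) ^ (1 - q) :=
                ENNReal.mul_rpow_of_nonneg _ _ (by linarith)
            _ ≤ S ^ (1 - q) * growth N (z - x₀) := by
                gcongr
                -- The weight is at least `1`, so its power `1 - q ≤ 1` may be replaced by the
                -- weight itself.
                calc _ ≤ growth N (z - x₀) ^ (1 : ℝ) :=
                      ENNReal.rpow_le_rpow_of_exponent_le (one_le_growth _ _) (by linarith)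
                  _ = _ := ENNReal.rpow_one _
            _ ≤ _ := by
                gcongr
                refine (growth_le N z x x₀).trans_eq ?_
                rw [← neg_sub, growth_neg]
        calc K (x - z) * G z = K (x - z) * (G z ^ (1 - q) * G z ^ q) := by rw [← h1]
          _ ≤ K (x - z) * (S ^ (1 - q) * (growth N (x - z) * growth N (x - x₀)) * G z ^ q) := by
              gcongr
          _ = S ^ (1 - q) * (K (x - z) * growth N (x - z)) * growth N (x - x₀) * G z ^ q := by
              ring
          _ ≤ _ := by gcongr; exact hK _
      _ = _ := by
        rw [lintegral_const_mul _ (hGm.pow_const q)]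
        ring
  have hSle : S ^ q ≤ κ * ∫⁻ z, G z ^ q := by
    refine rpow_le_of_le_rpow_mul hq hStop (iSup_le fun z => ?_)
    rw [ENNReal.div_le_iff (hpos _) (growth_ne_top _ _)]
    exact hmain z
  refine le_trans (ENNReal.rpow_le_rpow ?_ hq.le) hSle
  simpa [growth] using hGS x₀

/-- The point is that the constant involves only `∫ K` and `sup K`, not the growth data `C`, `N`,
`κ'`. For `q ≥ 1` this is Hölder's inequality; the factor `(1 + ∫ K) ^ q` serves both ranges of `q`.
-/
theorem rpow_le_of_le_lintegral {q : ℝ} (hq : 0 < q) {G K : E n → ℝ≥0∞} (hGm : Measurable G)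
    (hKm : Measurable K) {N : ℕ} {C κ κ' : ℝ≥0∞} (hC : C ≠ ∞) (hG : ∀ x, G x ≤ C * growth N x)
    (hκ' : κ' ≠ ∞) (hK' : ∀ x, K x * growth N x ≤ κ') (hK : ∀ x, K x ≤ κ)
    (h : ∀ x, G x ≤ ∫⁻ z, K (x - z) * G z) (hGq : ∫⁻ z, G z ^ q ≠ ∞) (x : E n) :
    G x ^ q ≤ (1 + ∫⁻ z, K z) ^ q * κ * ∫⁻ z, G z ^ q := by
  rcases le_total q 1 with hq1 | hq1
  · set D := (κ' * ∫⁻ z, G z ^ q) ^ (1 / q) with hD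
    have hD' : D ≠ ∞ := ENNReal.rpow_ne_top_of_nonneg (by positivity) (ENNReal.mul_ne_top hκ' hGq)
    have h1 (x : E n) : G x ≤ D := by
      rw [hD, one_div, ENNReal.le_rpow_inv_iff hq]
      exact rpow_le_of_le_lintegral_of_growth hq hq1 hC hG hK' h hGm x
    -- A first application with weight `N` gave boundedness with a poor constant; a second one with
    -- the trivial weight `N = 0` replaces `κ'` by `κ`.
    refine (rpow_le_of_le_lintegral_of_growth (N := 0) (κ := κ) hq hq1 hD'
      (fun x => by simpa [growth] using h1 x) (fun x => by simpa [growth] using hK x) h hGm x).trans ?_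
    gcongr
    refine le_mul_of_one_le_left (zero_le) ?_
    exact ENNReal.one_le_rpow (le_self_add) hq
  · have hq' : 1 / q ≤ 1 := by rw [div_le_one hq]; exact hq1
    have h1 : G x ≤ (∫⁻ z, K z) ^ (1 - 1 / q) * (κ * ∫⁻ z, G z ^ q) ^ (1 / q) := by
      have hKx : Measurable fun z => K (x - z) := hKm.comp (measurable_const.sub measurable_id)
      calc G x ≤ ∫⁻ z, K (x - z) * G z := h x
        -- The splitting for Hölder's inequality with respect to the measure `K (x - z) dz`.
        _ = ∫⁻ z, K (x - z) ^ (1 - 1 / q) * (K (x - z) * G z ^ q) ^ (1 / q) := by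
          refine lintegral_congr fun z => ?_
          rw [ENNReal.mul_rpow_of_nonneg _ _ (by positivity), ← ENNReal.rpow_mul,
            mul_one_div_cancel hq.ne', ENNReal.rpow_one, ← mul_assoc,
            ← ENNReal.rpow_add_of_nonneg _ _ (by linarith) (by positivity), sub_add_cancel,
            ENNReal.rpow_one]
        _ ≤ (∫⁻ z, K (x - z)) ^ (1 - 1 / q) * (∫⁻ z, K (x - z) * G z ^ q) ^ (1 / q) :=
          ENNReal.lintegral_mul_norm_pow_le hKx.aemeasurable
            (hKx.mul (hGm.pow_const q)).aemeasurable (by linarith) (by positivity) (by ring)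
        _ ≤ _ := by
          rw [lintegral_sub_left_eq_self K x]
          gcongr
          rw [← lintegral_const_mul _ (hGm.pow_const q)]
          exact lintegral_mono fun z => by gcongr; exact hK _
    calc G x ^ q ≤ ((∫⁻ z, K z) ^ (1 - 1 / q) * (κ * ∫⁻ z, G z ^ q) ^ (1 / q)) ^ q :=
          ENNReal.rpow_le_rpow h1 hq.le
      _ = (∫⁻ z, K z) ^ (q - 1) * (κ * ∫⁻ z, G z ^ q) := by
          rw [ENNReal.mul_rpow_of_nonneg _ _ hq.le, ← ENNReal.rpow_mul, ← ENNReal.rpow_mul,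
            one_div_mul_cancel hq.ne', ENNReal.rpow_one, sub_mul, one_div_mul_cancel hq.ne', one_mul]
      _ ≤ (1 + ∫⁻ z, K z) ^ q * (κ * ∫⁻ z, G z ^ q) := by
          gcongr
          calc (∫⁻ z, K z) ^ (q - 1) ≤ (1 + ∫⁻ z, K z) ^ (q - 1) :=
                ENNReal.rpow_le_rpow le_add_self (by linarith)
            _ ≤ _ := ENNReal.rpow_le_rpow_of_exponent_le le_self_add (by linarith)
      _ = _ := by ring

/-- A pointwise bound in terms of the `L_q` norm gives a bound of the `L_p` norm, `q < p`. -/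
theorem lintegral_rpow_le_of_rpow_le {p q : ℝ} (hq : 0 < q) (hqp : q < p) {G : E n → ℝ≥0∞}
    (hGm : Measurable G) {B : ℝ≥0∞} (h : ∀ x, G x ^ q ≤ B * ∫⁻ z, G z ^ q) :
    (∫⁻ z, G z ^ p) ^ (1 / p) ≤ B ^ (1 / q - 1 / p) * (∫⁻ z, G z ^ q) ^ (1 / q) := by
  have hp : 0 < p := hq.trans hqp
  set I := ∫⁻ z, G z ^ q
  have hm : 0 ≤ (p - q) / q := div_nonneg (by linarith) hq.le
  have h1 : ∫⁻ z, G z ^ p ≤ (B * I) ^ ((p - q) / q) * I := by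
    rw [← lintegral_const_mul _ (hGm.pow_const q)]
    refine lintegral_mono fun z => ?_
    calc G z ^ p = (G z ^ q) ^ ((p - q) / q) * G z ^ q := by
          rw [← ENNReal.rpow_mul, mul_div_cancel₀ _ hq.ne',
            ← ENNReal.rpow_add_of_nonneg _ _ (by linarith) hq.le, sub_add_cancel]
      _ ≤ _ := by gcongr; exact h z
  calc (∫⁻ z, G z ^ p) ^ (1 / p) ≤ ((B * I) ^ ((p - q) / q) * I) ^ (1 / p) :=
        ENNReal.rpow_le_rpow h1 (by positivity)
    _ = B ^ (1 / q - 1 / p) * I ^ (1 / q) := by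
        have e1 : (p - q) / q * (1 / p) = 1 / q - 1 / p := by field_simp
        have e2 : 0 ≤ 1 / q - 1 / p := by rw [← e1]; positivity
        rw [ENNReal.mul_rpow_of_nonneg _ _ (by positivity), ← ENNReal.rpow_mul, e1,
          ENNReal.mul_rpow_of_nonneg _ _ e2, mul_assoc,
          ← ENNReal.rpow_add_of_nonneg _ _ e2 (by positivity), sub_add_cancel]

theorem lintegral_enorm_rescale (ψ : 𝓢(E n, ℂ)) {c : ℝ} (hc : 0 < c) :
    ∫⁻ z, ‖rescale ψ c hc.ne' z‖ₑ = ∫⁻ z, ‖ψ z‖ₑ := by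
  rw [← ofReal_integral_norm_eq_lintegral_enorm (rescale ψ c hc.ne').integrable,
    ← ofReal_integral_norm_eq_lintegral_enorm ψ.integrable]
  congr 1
  have h1 := Measure.integral_comp_smul (volume : Measure (E n)) (fun y => ‖ψ y‖) c
  rw [finrank_euclideanSpace_fin, abs_of_pos (by positivity)] at h1
  simp_rw [rescale_apply, norm_mul, Complex.norm_real, Real.norm_of_nonneg (pow_nonneg hc.le n)]
  rw [integral_const_mul, h1, smul_eq_mul, mul_inv_cancel_left₀ (by positivity)]

theorem weightedLpNorm_of_lt_top {p : ℝ≥0∞} (hp : p ≠ ∞) (w : E n → ℝ) (g : E n → ℂ) :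
    weightedLpNorm p w g
      = (∫⁻ x, ‖g x‖ₑ ^ p.toReal * ENNReal.ofReal (w x)) ^ (1 / p.toReal) := if_neg hp

theorem weightedLpNorm_one_of_lt_top {p : ℝ≥0∞} (hp : p ≠ ∞) (g : E n → ℂ) :
    weightedLpNorm p (fun _ => 1) g = (∫⁻ x, ‖g x‖ₑ ^ p.toReal) ^ (1 / p.toReal) := by
  simp [weightedLpNorm_of_lt_top hp]

theorem weightedLpNorm_one_le {p : ℝ≥0∞} (hp : p ≠ ∞) {w : E n → ℝ} (hw : ∀ x, 1 ≤ w x)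
    (g : E n → ℂ) : weightedLpNorm p (fun _ => 1) g ≤ weightedLpNorm p w g := by
  rw [weightedLpNorm_of_lt_top hp, weightedLpNorm_of_lt_top hp]
  gcongr with x
  exact hw x

theorem recip_eq {p : ℝ≥0∞} : recip p = 1 / p.toReal := by
  rw [recip, ENNReal.toReal_inv, one_div]

/-- Nikolskii's inequality for the functions `φ_k * f`. -/
theorem exists_weightedLpNorm_conv_le (n : ℕ) {p q : ℝ≥0∞} (hq : 0 < q) (hqp : q < p)
    (hp : p ≠ ∞) : ∃ C : ℝ≥0, ∀ (P : DyadicPartition n) (k : ℤ) (f : DotDistribution n),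
      weightedLpNorm q (fun _ => 1) (P.conv k f) ≠ ∞ →
      weightedLpNorm p (fun _ => 1) (P.conv k f) ≤ C * (2 : ℝ≥0∞) ^ (n * (recip q - recip p) * k)
        * weightedLpNorm q (fun _ => 1) (P.conv k f) := by
  obtain ⟨ψ, hψ⟩ := exists_reproducing_kernel n
  have hq' : q ≠ ∞ := (hqp.trans_le le_top).ne
  have hq0 : 0 < q.toReal := ENNReal.toReal_pos hq.ne' hq'
  have hqp' : q.toReal < p.toReal := (ENNReal.toReal_lt_toReal hq' hp).2 hqp
  have hp0 : 0 < p.toReal := hq0.trans hqp'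
  have he : 0 ≤ recip q - recip p := by
    rw [recip_eq, recip_eq, sub_nonneg]
    exact one_div_le_one_div_of_le hq0 hqp'.le
  obtain ⟨M, hM0, hM⟩ := exists_one_add_pow_mul_iteratedFDeriv_le ψ 0 0
  have hM (x : E n) : ‖ψ x‖ ≤ M := by simpa using hM x
  -- Rescaling preserves the `L_1` norm of `ψ` and multiplies its supremum by `2^{kn}`, so `J` is
  -- the part of the constant that does not depend on `k`. The growth constants of `φ_k * f` chosen
  -- below do not enter it.
  set J : ℝ≥0∞ := (1 + ∫⁻ z, ‖ψ z‖ₑ) ^ q.toReal * ENNReal.ofReal M with hJ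
  have hJtop : J ≠ ∞ := by
    refine ENNReal.mul_ne_top (ENNReal.rpow_ne_top_of_nonneg hq0.le ?_) ENNReal.ofReal_ne_top
    exact ENNReal.add_ne_top.2 ⟨ENNReal.one_ne_top, ψ.integrable.2.ne⟩
  refine ⟨(J ^ (recip q - recip p)).toNNReal, fun P k f hfin => ?_⟩
  rw [ENNReal.coe_toNNReal (ENNReal.rpow_ne_top_of_nonneg he hJtop)]
  have hc : (0 : ℝ) < 2 ^ k := by positivity
  set Ψ := rescale ψ ((2 : ℝ) ^ k) (zpow_ne_zero k two_ne_zero) with hΨ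
  obtain ⟨C, N, hC0, hC⟩ := P.exists_norm_conv_le k f
  obtain ⟨κ', hκ0, hκ'⟩ := exists_one_add_pow_mul_iteratedFDeriv_le Ψ N 0
  have hGm : Measurable fun x => ‖P.conv k f x‖ₑ := (P.continuous_conv k f).measurable.enorm
  have hfin' : ∫⁻ x, ‖P.conv k f x‖ₑ ^ q.toReal ≠ ∞ := by
    intro htop
    rw [weightedLpNorm_one_of_lt_top hq', htop, ENNReal.top_rpow_of_pos (by positivity)] at hfin
    exact hfin rfl
  have key := fun x => rpow_le_of_le_lintegral hq0 hGm (K := fun x => ‖Ψ x‖ₑ)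
    Ψ.continuous.measurable.enorm (N := N) (C := ENNReal.ofReal C) (κ' := ENNReal.ofReal κ')
    (κ := ENNReal.ofReal ((2 ^ k) ^ n) * ENNReal.ofReal M) ENNReal.ofReal_ne_top
    (fun x => by
      rw [growth, ← ENNReal.ofReal_mul hC0, ← ofReal_norm]
      exact ENNReal.ofReal_le_ofReal (hC x)) ENNReal.ofReal_ne_top
    (fun x => by
      rw [growth, ← ofReal_norm, ← ENNReal.ofReal_mul (norm_nonneg _)]
      refine ENNReal.ofReal_le_ofReal ?_
      rw [mul_comm]
      simpa using hκ' x)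
    (fun x => by
      rw [← ENNReal.ofReal_mul (by positivity), ← ofReal_norm]
      refine ENNReal.ofReal_le_ofReal ?_
      rw [hΨ, rescale_apply, norm_mul, Complex.norm_real, Real.norm_of_nonneg (by positivity)]
      gcongr
      exact hM _)
    (fun x => by
      rw [hψ P k f x]
      refine (enorm_integral_le_lintegral_enorm _).trans_eq ?_
      rw [← lintegral_sub_left_eq_self _ x]
      simp [enorm_mul, Ψ]) hfin' x
  have h2 := lintegral_rpow_le_of_rpow_le hq0 hqp' hGm key
  rw [weightedLpNorm_one_of_lt_top hp, weightedLpNorm_one_of_lt_top hq']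
  refine h2.trans_eq ?_
  congr 1
  rw [hΨ, lintegral_enorm_rescale ψ hc, mul_left_comm, ← hJ,
    ENNReal.mul_rpow_of_nonneg _ _ (by rwa [recip_eq, recip_eq] at he), ← recip_eq, ← recip_eq,
    mul_comm]
  congr 1
  rw [← zpow_natCast, ← zpow_mul, ← Real.rpow_intCast, ← ENNReal.ofReal_rpow_of_pos two_pos,
    ← ENNReal.rpow_mul]
  congr 1
  · simp
  · push_cast; ring

end Nikolskii

/-! ### The weights and Hölder's inequality -/

section Weights

variable {n : ℕ}

/-- Exchanging `q` and `r` replaces `γ` by `1 - γ`; the conventions at infinity match as well. This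
reduces the case `r < p < q` to the other one. -/
theorem weightU_swap {p q r : ℝ≥0∞} (hr : r < p) (hq : p < q) (u : E n → ℝ) :
    weightU p q r u = weightV p r q u := by
  funext x
  have hr' : r ≠ ∞ := (hr.trans_le le_top).ne
  by_cases hq' : q = ∞
  · simp [weightU, weightV, hq']
  · have hp' : p ≠ ∞ := (hq.trans_le le_top).ne
    have h1 : r.toReal < q.toReal := (ENNReal.toReal_lt_toReal hr' hq').2 (hr.trans hq)
    have h2 : q.toReal - r.toReal ≠ 0 := (sub_pos.2 h1).ne'
    simp only [weightU, weightV, gammaExp, hq', hr', hr, hq.not_gt, if_false, if_true]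
    congr 2
    field_simp
    ring

theorem weightV_swap {p q r : ℝ≥0∞} (hr : r < p) (hq : p < q) (v : E n → ℝ) :
    weightV p q r v = weightU p r q v := by
  funext x
  have hr' : r ≠ ∞ := (hr.trans_le le_top).ne
  by_cases hq' : q = ∞
  · simp [weightU, weightV, gammaExp, hq', hr']
  · have hp' : p ≠ ∞ := (hq.trans_le le_top).ne
    have h1 : r.toReal < q.toReal := (ENNReal.toReal_lt_toReal hr' hq').2 (hr.trans hq)
    have h2 : q.toReal - r.toReal ≠ 0 := (sub_pos.2 h1).ne'
    simp only [weightU, weightV, gammaExp, hq', hr', hr, hq.not_gt, if_false, if_true]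
    congr 2
    field_simp
    ring

theorem gammaExp_mem {p q r : ℝ≥0∞} (hq : q < p) (hr : p < r) (hr' : r ≠ ∞) :
    gammaExp p q r = (p.toReal - q.toReal) / (r.toReal - q.toReal) ∧
      0 < gammaExp p q r ∧ gammaExp p q r < 1 := by
  have hp' : p ≠ ∞ := (hr.trans_le le_top).ne
  have hq' : q ≠ ∞ := (hq.trans_le le_top).ne
  have h1 : q.toReal < p.toReal := (ENNReal.toReal_lt_toReal hq' hp').2 hq
  have h2 : p.toReal < r.toReal := (ENNReal.toReal_lt_toReal hp' hr').2 hr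
  have h0 : gammaExp p q r = (p.toReal - q.toReal) / (r.toReal - q.toReal) := by
    simp [gammaExp, hr', hq', hq]
  refine ⟨h0, ?_, ?_⟩ <;> rw [h0]
  · exact div_pos (by linarith) (by linarith)
  · rw [div_lt_one (by linarith)]; linarith

theorem one_le_weightU {p q r : ℝ≥0∞} (hq : q < p) (hr : p < r) {u : E n → ℝ}
    (hu : ∀ x, 1 ≤ u x) (x : E n) : 1 ≤ weightU p q r u x := by
  have hq' : q ≠ ∞ := (hq.trans_le le_top).ne
  rw [weightU, if_neg hq']
  refine Real.one_le_rpow (hu x) ?_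
  by_cases hr' : r = ∞
  · simp [gammaExp, hr']
  · have := (gammaExp_mem hq hr hr').2.2
    exact one_div_nonneg.2 (by linarith)

/-- Hölder's inequality with weights. -/
theorem weightedLpNorm_le_mul {p q r : ℝ≥0∞} (hq0 : 0 < q) (hq : q < p) (hr : p < r)
    {u v : E n → ℝ} (hu : AEMeasurable u volume) (hv : AEMeasurable v volume)
    (huv : ∀ x, 1 ≤ u x * v x) (hu1 : ∀ x, 1 ≤ u x) {β : ℝ}
    (hβ : β = (recip q - recip p) / (recip q - recip r)) {g : E n → ℂ} (hg : Measurable g) :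
    weightedLpNorm p (fun _ => 1) g ≤
      weightedLpNorm q (weightU p q r u) g ^ (1 - β) * weightedLpNorm r (weightV p q r v) g ^ β := by
  have hp' : p ≠ ∞ := (hr.trans_le le_top).ne
  have hq' : q ≠ ∞ := (hq.trans_le le_top).ne
  have hq0' : 0 < q.toReal := ENNReal.toReal_pos hq0.ne' hq'
  have hqp : q.toReal < p.toReal := (ENNReal.toReal_lt_toReal hq' hp').2 hq
  have hp0 : 0 < p.toReal := hq0'.trans hqp
  have hu0 (x : E n) : 0 < u x := one_pos.trans_le (hu1 x)
  have hv0 (x : E n) : 0 < v x := pos_of_mul_pos_right (one_pos.trans_le (huv x)) (hu0 x).le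
  have huv' (x : E n) : 1 ≤ ENNReal.ofReal (u x) * ENNReal.ofReal (v x) := by
    rw [← ENNReal.ofReal_mul (hu0 x).le, ENNReal.one_le_ofReal]
    exact huv x
  rw [weightedLpNorm_one_of_lt_top hp', weightedLpNorm_of_lt_top hq']
  by_cases hr' : r = ∞
  · have hV : weightedLpNorm r (weightV p q r v) g
        = essSup (fun x => ‖g x‖ₑ * ENNReal.ofReal (v x ^ (1 / (p.toReal - q.toReal)))) volume := by
      simp [weightedLpNorm, weightV, hr']
    have hU (x : E n) : weightU p q r u x = u x := by simp [weightU, gammaExp, hr', hq']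
    have hβ' : β = (p.toReal - q.toReal) / p.toReal := by
      rw [hβ, hr', recip_eq, recip_eq, recip_eq]
      simp only [ENNReal.toReal_top, div_zero, sub_zero]
      field_simp
    simp_rw [hU]
    rw [hV]
    set S := essSup (fun x => ‖g x‖ₑ * ENNReal.ofReal (v x ^ (1 / (p.toReal - q.toReal)))) volume
    have hpq : 0 < p.toReal - q.toReal := by linarith
    have h1 : ∫⁻ x, ‖g x‖ₑ ^ p.toReal
        ≤ (∫⁻ x, ‖g x‖ₑ ^ q.toReal * ENNReal.ofReal (u x)) * S ^ (p.toReal - q.toReal) := by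
      have hm : AEMeasurable (fun x => ‖g x‖ₑ ^ q.toReal * ENNReal.ofReal (u x)) volume :=
        (hg.enorm.pow_const _).aemeasurable.mul hu.ennreal_ofReal
      rw [← lintegral_mul_const'' _ hm]
      refine lintegral_mono_ae ?_
      filter_upwards [ENNReal.ae_le_essSup
        (fun x => ‖g x‖ₑ * ENNReal.ofReal (v x ^ (1 / (p.toReal - q.toReal))))] with x hx
      calc ‖g x‖ₑ ^ p.toReal ≤ ‖g x‖ₑ ^ p.toReal * (ENNReal.ofReal (u x) * ENNReal.ofReal (v x)) :=
            le_mul_of_one_le_right zero_le (huv' x)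
        _ = ‖g x‖ₑ ^ q.toReal * ENNReal.ofReal (u x) *
            (‖g x‖ₑ * ENNReal.ofReal (v x ^ (1 / (p.toReal - q.toReal))))
              ^ (p.toReal - q.toReal) := by
            rw [ENNReal.mul_rpow_of_nonneg _ _ hpq.le,
              ENNReal.ofReal_rpow_of_pos (Real.rpow_pos_of_pos (hv0 x) _),
              ← Real.rpow_mul (hv0 x).le, one_div_mul_cancel hpq.ne', Real.rpow_one]
            have : ‖g x‖ₑ ^ p.toReal = ‖g x‖ₑ ^ q.toReal * ‖g x‖ₑ ^ (p.toReal - q.toReal) := by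
              rw [← ENNReal.rpow_add_of_nonneg _ _ hq0'.le hpq.le, add_sub_cancel]
            rw [this]
            ring
        _ ≤ _ := by gcongr
    refine (ENNReal.rpow_le_rpow h1 (by positivity : 0 ≤ 1 / p.toReal)).trans_eq ?_
    rw [ENNReal.mul_rpow_of_nonneg _ _ (by positivity), ← ENNReal.rpow_mul, ← ENNReal.rpow_mul, hβ']
    congr 2 <;> field_simp
    ring
  · obtain ⟨hγ, hγ0, hγ1⟩ := gammaExp_mem hq hr hr'
    have hpr : p.toReal < r.toReal := (ENNReal.toReal_lt_toReal hp' hr').2 hr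
    have hr0 : 0 < r.toReal := hp0.trans hpr
    have hqr : r.toReal - q.toReal ≠ 0 := by linarith
    have hV (x : E n) : weightV p q r v x = v x ^ (1 / gammaExp p q r) := by simp [weightV, hr']
    have hU (x : E n) : weightU p q r u x = u x ^ (1 / (1 - gammaExp p q r)) := by
      simp [weightU, hq']
    have hβ' : β = r.toReal * gammaExp p q r / p.toReal := by
      have : r.toReal * p.toReal - q.toReal * p.toReal ≠ 0 := by
        rw [← sub_mul]; exact mul_ne_zero hqr hp0.ne'
      rw [hβ, recip_eq, recip_eq, recip_eq, hγ, div_sub_div _ _ hq0'.ne' hp0.ne',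
        div_sub_div _ _ hq0'.ne' hr0.ne']
      field_simp
    -- So `|g|^p ≤ (|g|^q u^{1/(1-γ)})^{1-γ} (|g|^r v^{1/γ})^γ` by `uv ≥ 1`, and Hölder's inequality
    -- applies with exponents `1 - γ` and `γ`.
    have hpγ : p.toReal = q.toReal * (1 - gammaExp p q r) + r.toReal * gammaExp p q r := by
      rw [hγ]; field_simp; ring
    rw [weightedLpNorm_of_lt_top hr']
    simp_rw [hU, hV]
    set γ := gammaExp p q r
    have h1γ : 0 < 1 - γ := by linarith
    have h1 : ∫⁻ x, ‖g x‖ₑ ^ p.toReal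
        ≤ (∫⁻ x, ‖g x‖ₑ ^ q.toReal * ENNReal.ofReal (u x ^ (1 / (1 - γ)))) ^ (1 - γ)
          * (∫⁻ x, ‖g x‖ₑ ^ r.toReal * ENNReal.ofReal (v x ^ (1 / γ))) ^ γ := by
      refine le_trans (lintegral_mono fun x => ?_) (ENNReal.lintegral_mul_norm_pow_le
        ((hg.enorm.pow_const _).aemeasurable.mul (hu.pow_const _).ennreal_ofReal)
        ((hg.enorm.pow_const _).aemeasurable.mul (hv.pow_const _).ennreal_ofReal)
        h1γ.le hγ0.le (by ring))
      calc ‖g x‖ₑ ^ p.toReal ≤ ‖g x‖ₑ ^ p.toReal * (ENNReal.ofReal (u x) * ENNReal.ofReal (v x)) :=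
            le_mul_of_one_le_right zero_le (huv' x)
        _ = (‖g x‖ₑ ^ q.toReal * ENNReal.ofReal (u x ^ (1 / (1 - γ)))) ^ (1 - γ)
            * (‖g x‖ₑ ^ r.toReal * ENNReal.ofReal (v x ^ (1 / γ))) ^ γ := by
            rw [ENNReal.mul_rpow_of_nonneg _ _ h1γ.le, ENNReal.mul_rpow_of_nonneg _ _ hγ0.le,
              ENNReal.ofReal_rpow_of_pos (Real.rpow_pos_of_pos (hv0 x) _),
              ENNReal.ofReal_rpow_of_pos (Real.rpow_pos_of_pos (hu0 x) _),
              ← Real.rpow_mul (hv0 x).le, ← Real.rpow_mul (hu0 x).le,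
              one_div_mul_cancel hγ0.ne', one_div_mul_cancel h1γ.ne', Real.rpow_one, Real.rpow_one,
              ← ENNReal.rpow_mul, ← ENNReal.rpow_mul]
            conv_lhs => rw [hpγ, ENNReal.rpow_add_of_nonneg _ _ (by positivity) (by positivity)]
            ring
    refine (ENNReal.rpow_le_rpow h1 (by positivity : 0 ≤ 1 / p.toReal)).trans_eq ?_
    have hβ1 : 1 - β = q.toReal * (1 - γ) / p.toReal := by
      rw [hβ', eq_div_iff hp0.ne', sub_mul, div_mul_cancel₀ _ hp0.ne']
      linarith
    rw [ENNReal.mul_rpow_of_nonneg _ _ (by positivity), ← ENNReal.rpow_mul, ← ENNReal.rpow_mul,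
      ← ENNReal.rpow_mul, ← ENNReal.rpow_mul, hβ1, hβ']
    congr 2 <;> field_simp

end Weights

/-! ### Sequences dominated by two geometric sequences -/

section Summation

theorem tsum_two_rpow_neg_natAbs_ne_top {c : ℝ} (hc : 0 < c) :
    ∑' i : ℤ, (2 : ℝ≥0∞) ^ (-c * (i.natAbs : ℝ)) ≠ ∞ := by
  obtain ⟨ρ, hρ⟩ : ∃ ρ : ℝ≥0, ρ = (2 : ℝ≥0) ^ (-c) := ⟨_, rfl⟩
  have hρ1 : ρ < 1 := hρ ▸ NNReal.rpow_lt_one_of_one_lt_of_neg one_lt_two (by linarith)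
  have hρ2 : (2 : ℝ≥0∞) ^ (-c) = ρ := by
    rw [hρ, ENNReal.coe_rpow_of_ne_zero two_ne_zero]
    simp
  have h1 (i : ℤ) : (2 : ℝ≥0∞) ^ (-c * (i.natAbs : ℝ)) = ((ρ ^ i.natAbs : ℝ≥0) : ℝ≥0∞) := by
    rw [ENNReal.rpow_mul, ENNReal.rpow_natCast, ENNReal.coe_pow, hρ2]
  rw [tsum_congr h1, ENNReal.tsum_coe_ne_top_iff_summable, ← NNReal.summable_coe]
  have h2 : Summable fun k : ℕ => (ρ : ℝ) ^ k :=
    summable_geometric_of_lt_one ρ.2 (by exact_mod_cast hρ1)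
  refine Summable.of_nat_of_neg ?_ ?_ <;> simpa using h2

theorem two_rpow_add (x y : ℝ) : (2 : ℝ≥0∞) ^ (x + y) = 2 ^ x * 2 ^ y :=
  ENNReal.rpow_add _ _ two_ne_zero ENNReal.ofNat_ne_top

theorem exists_eq_two_rpow {M : ℝ≥0∞} (hM0 : M ≠ 0) (hM : M ≠ ∞) :
    ∃ x : ℝ, M = (2 : ℝ≥0∞) ^ x := by
  refine ⟨Real.logb 2 M.toReal, ?_⟩
  have h := Real.rpow_logb two_pos (by norm_num) (ENNReal.toReal_pos hM0 hM)
  conv_lhs => rw [← ENNReal.ofReal_toReal hM, ← h, ← ENNReal.ofReal_rpow_of_pos two_pos]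
  simp

/-- The two bounds cross at some real `t`, with common value `M^{b/(a+b)} N^{a/(a+b)}`. Away from
`t` the smaller one decays at least like `2^{-min(a,b)|k-t|}`, so the sum is comparable to the value
at the crossing. -/
theorem exists_tsum_rpow_le_of_pos {a b η : ℝ} (ha : 0 < a) (hb : 0 < b) (hη : 0 < η) :
    ∃ C : ℝ≥0, ∀ (Y : ℤ → ℝ≥0∞) (M N : ℝ≥0∞), M ≠ ∞ → N ≠ ∞ →
      (∀ k : ℤ, Y k ≤ M * 2 ^ (a * k)) → (∀ k : ℤ, Y k ≤ N * 2 ^ (-b * k)) →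
      (∑' k, Y k ^ η) ^ (1 / η) ≤ C * M ^ (b / (a + b)) * N ^ (a / (a + b)) := by
  set c := min a b with hc
  have hc0 : 0 < c := lt_min ha hb
  set W : ℝ≥0∞ := ∑' i : ℤ, (2 : ℝ≥0∞) ^ (-(c * η) * (i.natAbs : ℝ))
  have hW : W ≠ ∞ := tsum_two_rpow_neg_natAbs_ne_top (mul_pos hc0 hη)
  have hCtop : (2 : ℝ≥0∞) ^ b * W ^ (1 / η) ≠ ∞ :=
    ENNReal.mul_ne_top (ENNReal.rpow_ne_top_of_nonneg hb.le ENNReal.ofNat_ne_top)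
      (ENNReal.rpow_ne_top_of_nonneg (by positivity) hW)
  refine ⟨((2 : ℝ≥0∞) ^ b * W ^ (1 / η)).toNNReal, fun Y M N hM hN hYM hYN => ?_⟩
  rw [ENNReal.coe_toNNReal hCtop]
  have hab : 0 < a + b := by linarith
  have hzero (hY : ∀ k, Y k = 0) : (∑' k, Y k ^ η) ^ (1 / η) ≤
      (2 : ℝ≥0∞) ^ b * W ^ (1 / η) * M ^ (b / (a + b)) * N ^ (a / (a + b)) := by
    simp [hY, ENNReal.zero_rpow_of_pos hη, ENNReal.zero_rpow_of_pos (inv_pos.2 hη)]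
  rcases eq_or_ne M 0 with hM0 | hM0
  · exact hzero fun k => by simpa [hM0] using hYM k
  rcases eq_or_ne N 0 with hN0 | hN0
  · exact hzero fun k => by simpa [hN0] using hYN k
  obtain ⟨x, rfl⟩ := exists_eq_two_rpow hM0 hM
  obtain ⟨y, rfl⟩ := exists_eq_two_rpow hN0 hN
  -- `t` solves `2^x 2^{at} = 2^y 2^{-bt}`, and `2^z` is the common value. Recentring at `⌊t⌋`
  -- instead of `t` costs at most the factor `2^b`.
  set t : ℝ := (y - x) / (a + b) with ht
  set z : ℝ := x * (b / (a + b)) + y * (a / (a + b)) with hz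
  have hzx : x = z - a * t := by rw [hz, ht]; field_simp; ring
  have hzy : y = z + b * t := by rw [hz, ht]; field_simp; ring
  have hQ : ((2 : ℝ≥0∞) ^ x) ^ (b / (a + b)) * ((2 : ℝ≥0∞) ^ y) ^ (a / (a + b)) = 2 ^ z := by
    rw [← ENNReal.rpow_mul, ← ENNReal.rpow_mul, ← two_rpow_add]
  have hY (i : ℤ) : Y (i + ⌊t⌋) ≤ 2 ^ (z + b) * 2 ^ (-c * (i.natAbs : ℝ)) := by
    have hf1 := Int.floor_le t
    have hf2 := Int.lt_floor_add_one t
    rw [← two_rpow_add]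
    rcases le_total 0 i with hi | hi
    · have hi' : (i.natAbs : ℝ) = i := by
        rw [← Int.cast_natCast, Int.natCast_natAbs, abs_of_nonneg hi]
      have hi0 : (0 : ℝ) ≤ i := by exact_mod_cast hi
      refine (hYN _).trans ?_
      rw [← two_rpow_add, hi']
      refine ENNReal.rpow_le_rpow_of_exponent_le one_le_two ?_
      push_cast
      rw [hzy]
      nlinarith [mul_le_mul_of_nonneg_right (min_le_right a b) hi0]
    · have hi' : (i.natAbs : ℝ) = -i := by
        rw [← Int.cast_natCast, Int.natCast_natAbs, abs_of_nonpos hi, Int.cast_neg]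
      have hi0 : (0 : ℝ) ≤ -i := by exact_mod_cast neg_nonneg.2 hi
      refine (hYM _).trans ?_
      rw [← two_rpow_add, hi']
      refine ENNReal.rpow_le_rpow_of_exponent_le one_le_two ?_
      push_cast
      rw [hzx]
      nlinarith [mul_le_mul_of_nonneg_right (min_le_left a b) hi0]
  rw [mul_assoc, hQ]
  calc (∑' k, Y k ^ η) ^ (1 / η) = (∑' i : ℤ, Y (i + ⌊t⌋) ^ η) ^ (1 / η) := by
        rw [← (Equiv.addRight ⌊t⌋).tsum_eq]; rfl
    _ ≤ (∑' i : ℤ, (2 : ℝ≥0∞) ^ ((z + b) * η) * 2 ^ (-(c * η) * (i.natAbs : ℝ))) ^ (1 / η) := by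
        gcongr with i
        refine (ENNReal.rpow_le_rpow (hY i) hη.le).trans_eq ?_
        rw [ENNReal.mul_rpow_of_nonneg _ _ hη.le, ← ENNReal.rpow_mul, ← ENNReal.rpow_mul]
        congr 2
        ring
    _ = 2 ^ (z + b) * W ^ (1 / η) := by
        rw [ENNReal.tsum_mul_left, ENNReal.mul_rpow_of_nonneg _ _ (by positivity),
          ← ENNReal.rpow_mul, mul_assoc, mul_one_div_cancel hη.ne', mul_one]
    _ = _ := by rw [two_rpow_add]; ring

/-- Summation of a sequence that is dominated by two geometric sequences. -/
theorem exists_tsum_rpow_le {a b η : ℝ} (hab : (0 < a ∧ 0 < b) ∨ (a < 0 ∧ b < 0)) (hη : 0 < η) :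
    ∃ C : ℝ≥0, ∀ (Y : ℤ → ℝ≥0∞) (M N : ℝ≥0∞), M ≠ ∞ → N ≠ ∞ →
      (∀ k : ℤ, Y k ≤ M * 2 ^ (a * k)) → (∀ k : ℤ, Y k ≤ N * 2 ^ (-b * k)) →
      (∑' k, Y k ^ η) ^ (1 / η) ≤ C * M ^ (b / (a + b)) * N ^ (a / (a + b)) := by
  rcases hab with ⟨ha, hb⟩ | ⟨ha, hb⟩
  · exact exists_tsum_rpow_le_of_pos ha hb hη
  · obtain ⟨C, hC⟩ := exists_tsum_rpow_le_of_pos (neg_pos.2 ha) (neg_pos.2 hb) hη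
    refine ⟨C, fun Y M N hM hN hYM hYN => ?_⟩
    -- Reversing the index changes the signs of `a` and `b`, while the exponents `a/(a+b)` and
    -- `b/(a+b)` stay the same.
    have h := hC (fun k => Y (-k)) M N hM hN (fun k => by simpa using hYM (-k))
      (fun k => by simpa using hYN (-k))
    rw [← neg_add, neg_div_neg_eq, neg_div_neg_eq] at h
    rwa [← (Equiv.neg ℤ).tsum_eq]

end Summation

/-! ### The interpolation inequality -/

section Interpolation

variable {n : ℕ}

theorem recip_lt_recip {p q : ℝ≥0∞} (hq : 0 < q) (hqp : q < p) : recip p < recip q := by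
  rw [recip, recip, ENNReal.toReal_lt_toReal (ENNReal.inv_ne_top.2 (hq.trans hqp).ne')
    (ENNReal.inv_ne_top.2 hq.ne')]
  exact ENNReal.inv_lt_inv.2 hqp

theorem weightedLpNorm_conv_le_besovNorm (P : DyadicPartition n) (s : ℝ) (p : ℝ≥0∞) (w : E n → ℝ)
    (f : DotDistribution n) (k : ℤ) :
    weightedLpNorm p w (P.conv k f) ≤ besovNorm P s p ∞ w f * 2 ^ (-s * k) := by
  have h1 : (2 : ℝ≥0∞) ^ (s * k) * weightedLpNorm p w (P.conv k f) ≤ besovNorm P s p ∞ w f := by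
    rw [besovNorm, if_pos rfl]
    exact le_iSup (fun k : ℤ => (2 : ℝ≥0∞) ^ (s * k) * weightedLpNorm p w (P.conv k f)) k
  calc weightedLpNorm p w (P.conv k f)
      = (2 : ℝ≥0∞) ^ (s * k) * weightedLpNorm p w (P.conv k f) * 2 ^ (-s * k) := by
        rw [mul_right_comm, ← two_rpow_add]
        simp
    _ ≤ _ := by gcongr

/-- The interpolation inequality for exponents `q < p < r`, with `σ` and `s` in any order. -/
theorem exists_besovNorm_le (n : ℕ) {p q r η : ℝ≥0∞} (hq0 : 0 < q) (hq : q < p) (hr : p < r)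
    (hη : 0 < η) (hη' : η < ∞) {τ σ s β : ℝ}
    (hβ : β = (recip q - recip p) / (recip q - recip r))
    (hab : (0 < τ - σ + n * (recip q - recip p) ∧ 0 < (1 - β) * σ + β * s - τ) ∨
      (τ - σ + n * (recip q - recip p) < 0 ∧ (1 - β) * σ + β * s - τ < 0)) :
    0 ≤ (τ - σ + n * (recip q - recip p)) / (s - σ + n * (recip q - recip r)) ∧
    (τ - σ + n * (recip q - recip p)) / (s - σ + n * (recip q - recip r)) ≤ 1 ∧
    s - σ + n * (recip q - recip r) ≠ 0 ∧
    ∀ P : DyadicPartition n, ∃ C : ℝ≥0, ∀ u v : E n → ℝ,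
      AEMeasurable u volume → AEMeasurable v volume → (∀ x, 1 ≤ u x * v x) → (∀ x, 1 ≤ u x) →
      ∀ f : DotDistribution n, besovNorm P σ q ∞ (weightU p q r u) f ≠ ∞ →
        besovNorm P s r ∞ (weightV p q r v) f ≠ ∞ →
        besovNorm P τ p η (fun _ => 1) f ≤ C *
          besovNorm P σ q ∞ (weightU p q r u) f ^
            (1 - (τ - σ + n * (recip q - recip p)) / (s - σ + n * (recip q - recip r))) *
          besovNorm P s r ∞ (weightV p q r v) f ^
            ((τ - σ + n * (recip q - recip p)) / (s - σ + n * (recip q - recip r))) := by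
  have hp' : p ≠ ∞ := (hr.trans_le le_top).ne
  have hq' : q ≠ ∞ := (hq.trans_le le_top).ne
  have hpq : recip p < recip q := recip_lt_recip hq0 hq
  have hrp : recip r < recip p := recip_lt_recip (hq0.trans hq) hr
  have hqr : 0 < recip q - recip r := by linarith
  have hβ0 : 0 < β := hβ ▸ div_pos (by linarith) hqr
  have hβ1 : β < 1 := by rw [hβ, div_lt_one hqr]; linarith
  have hβm : recip q - recip p = β * (recip q - recip r) := by
    rw [hβ, div_mul_cancel₀ _ hqr.ne']
  set a := τ - σ + n * (recip q - recip p) with ha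
  set b := (1 - β) * σ + β * s - τ with hb
  set D := s - σ + n * (recip q - recip r) with hD
  have hsum : a + b = β * D := by rw [ha, hb, hD, hβm]; ring
  have hab0 : a + b ≠ 0 := by rcases hab with ⟨h1, h2⟩ | ⟨h1, h2⟩ <;> linarith
  have hD0 : D ≠ 0 := fun h => hab0 (by rw [hsum, h, mul_zero])
  have haq : 0 ≤ a / (a + b) := by
    rcases hab with ⟨h1, h2⟩ | ⟨h1, h2⟩
    · exact div_nonneg h1.le (by linarith)
    · exact div_nonneg_of_nonpos h1.le (by linarith)
  have hbq : 0 ≤ b / (a + b) := by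
    rcases hab with ⟨h1, h2⟩ | ⟨h1, h2⟩
    · exact div_nonneg h2.le (by linarith)
    · exact div_nonneg_of_nonpos h2.le (by linarith)
  have hadd : a / (a + b) + b / (a + b) = 1 := by rw [← add_div, div_self hab0]
  have hδ : a / D = β * (a / (a + b)) := by rw [hsum]; field_simp
  have hδ0 : 0 ≤ a / D := by rw [hδ]; positivity
  -- The total exponent of `A`: it enters the Nikolskii bound to the power `1` and the Hölder bound
  -- to the power `1 - β`.
  have hδ1 : 1 - a / D = b / (a + b) + (1 - β) * (a / (a + b)) := by rw [hδ]; linarith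
  have hδ2 : 0 ≤ (1 - β) * (a / (a + b)) := mul_nonneg (by linarith) haq
  refine ⟨hδ0, by linarith, hD0, fun P => ?_⟩
  obtain ⟨C₁, hC₁⟩ := exists_weightedLpNorm_conv_le n hq0 hq hp'
  obtain ⟨C₂, hC₂⟩ := exists_tsum_rpow_le hab (ENNReal.toReal_pos hη.ne' hη'.ne)
  refine ⟨C₂ * C₁ ^ (b / (a + b)), fun u v hu hv huv hu1 f hA hB => ?_⟩
  have hle (k : ℤ) := weightedLpNorm_conv_le_besovNorm P σ q (weightU p q r u) f k
  have hle' (k : ℤ) := weightedLpNorm_conv_le_besovNorm P s r (weightV p q r v) f k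
  set A := besovNorm P σ q ∞ (weightU p q r u) f
  set B := besovNorm P s r ∞ (weightV p q r v) f
  have hX₁ (k : ℤ) : (2 : ℝ≥0∞) ^ (τ * k) * weightedLpNorm p (fun _ => 1) (P.conv k f)
      ≤ C₁ * A * 2 ^ (a * k) := by
    -- Here `u ≥ 1` is used: it lets the weighted norm control the unweighted one, whose finiteness
    -- Nikolskii's inequality requires.
    have h1 : weightedLpNorm q (fun _ => 1) (P.conv k f) ≤ A * 2 ^ (-σ * k) :=
      (weightedLpNorm_one_le hq' (one_le_weightU hq hr hu1) _).trans (hle k)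
    have h2 := hC₁ P k f (ne_top_of_le_ne_top (ENNReal.mul_ne_top hA
      (ENNReal.rpow_ne_top_of_ne_zero two_ne_zero ENNReal.ofNat_ne_top)) h1)
    calc _ ≤ (2 : ℝ≥0∞) ^ (τ * k) * (C₁ * 2 ^ (n * (recip q - recip p) * k)
          * (A * 2 ^ (-σ * k))) := by gcongr; exact h2.trans (by gcongr)
      _ = C₁ * A * (2 ^ (τ * k) * 2 ^ (n * (recip q - recip p) * k) * 2 ^ (-σ * k)) := by ring
      _ = _ := by
        rw [← two_rpow_add, ← two_rpow_add]
        congr 2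
        rw [ha]
        ring
  have hX₂ (k : ℤ) : (2 : ℝ≥0∞) ^ (τ * k) * weightedLpNorm p (fun _ => 1) (P.conv k f)
      ≤ A ^ (1 - β) * B ^ β * 2 ^ (-b * k) := by
    have h1 := weightedLpNorm_le_mul hq0 hq hr hu hv huv hu1 hβ
      (P.continuous_conv k f).measurable
    calc _ ≤ (2 : ℝ≥0∞) ^ (τ * k) * ((A * 2 ^ (-σ * k)) ^ (1 - β) * (B * 2 ^ (-s * k)) ^ β) := by
          gcongr
          refine h1.trans ?_
          gcongr
          · exact hle k
          · exact hle' k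
      _ = A ^ (1 - β) * B ^ β * (2 ^ (τ * k) * 2 ^ (-σ * k * (1 - β)) * 2 ^ (-s * k * β)) := by
          rw [ENNReal.mul_rpow_of_nonneg _ _ (by linarith), ENNReal.mul_rpow_of_nonneg _ _ hβ0.le,
            ← ENNReal.rpow_mul, ← ENNReal.rpow_mul]
          ring
      _ = _ := by
        rw [← two_rpow_add, ← two_rpow_add]
        congr 2
        rw [hb]
        ring
  have hfin := hC₂ _ _ _ (ENNReal.mul_ne_top ENNReal.coe_ne_top hA)
    (ENNReal.mul_ne_top (ENNReal.rpow_ne_top_of_nonneg (by linarith) hA)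
      (ENNReal.rpow_ne_top_of_nonneg hβ0.le hB)) hX₁ hX₂
  rw [besovNorm, if_neg hη'.ne]
  refine hfin.trans_eq ?_
  rw [ENNReal.mul_rpow_of_nonneg _ _ hbq, ENNReal.mul_rpow_of_nonneg _ _ haq, ← ENNReal.rpow_mul,
    ← ENNReal.rpow_mul, hδ1, ENNReal.rpow_add_of_nonneg _ _ hbq hδ2, hδ, ENNReal.coe_mul,
    ENNReal.coe_rpow_of_nonneg _ hbq]
  ring

end Interpolation

end WeightedBesov

theorem theorem1 (n : ℕ) (hn : 1 ≤ n) (P : WeightedBesov.DyadicPartition n)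
    (p q r : ℝ≥0∞) (hpqr : (0 < q ∧ q < p ∧ p < r) ∨ (0 < r ∧ r < p ∧ p < q))
    (τ σ s : ℝ) (hσs : σ < s) (η : ℝ≥0∞) (hη : 0 < η) (hη' : η < ∞)
    (hq : q < p → σ - τ < n * (WeightedBesov.recip q - WeightedBesov.recip p))
    (hr : r < p → n * (WeightedBesov.recip r - WeightedBesov.recip p) < s - τ)
    (θ : ℝ) (hθ : θ = (τ - σ) / (s - σ))
    (hcond : (1 - θ) * WeightedBesov.recip q + θ * WeightedBesov.recip r
      > WeightedBesov.recip p)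
    (δ : ℝ) (hδ : δ = (τ - σ + n * (WeightedBesov.recip q - WeightedBesov.recip p))
      / (s - σ + n * (WeightedBesov.recip q - WeightedBesov.recip r))) :
    ∃ C : ℝ≥0, ∀ u v : WeightedBesov.E n → ℝ,
      AEMeasurable u volume → AEMeasurable v volume →
      (∀ x, 1 ≤ u x * v x) →
      (q < p → ∀ x, 1 ≤ u x) →
      (r < p → ∀ x, 1 ≤ v x) →
      ∀ f ∈ WeightedBesov.besovSpace P σ q ∞ (WeightedBesov.weightU p q r u) ∩
          WeightedBesov.besovSpace P s r ∞ (WeightedBesov.weightV p q r v),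
        f ∈ WeightedBesov.besovSpace P τ p η (fun _ => 1) ∧
        (s - n * WeightedBesov.recip r ≠ σ - n * WeightedBesov.recip q →
          WeightedBesov.besovNorm P τ p η (fun _ => 1) f ≤
            C * WeightedBesov.besovNorm P σ q ∞ (WeightedBesov.weightU p q r u) f ^ (1 - δ) *
              WeightedBesov.besovNorm P s r ∞ (WeightedBesov.weightV p q r v) f ^ δ) := by
  -- With `0 ≤ δ ≤ 1` both exponents are nonnegative, so the right side is finite even if one of the
  -- norms vanishes, and membership follows from the inequality.
  suffices h : ∃ C : ℝ≥0, 0 ≤ δ ∧ δ ≤ 1 ∧ ∀ u v : WeightedBesov.E n → ℝ,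
      AEMeasurable u volume → AEMeasurable v volume → (∀ x, 1 ≤ u x * v x) →
      (q < p → ∀ x, 1 ≤ u x) → (r < p → ∀ x, 1 ≤ v x) → ∀ f,
      WeightedBesov.besovNorm P σ q ∞ (WeightedBesov.weightU p q r u) f ≠ ∞ →
      WeightedBesov.besovNorm P s r ∞ (WeightedBesov.weightV p q r v) f ≠ ∞ →
      WeightedBesov.besovNorm P τ p η (fun _ => 1) f ≤
        C * WeightedBesov.besovNorm P σ q ∞ (WeightedBesov.weightU p q r u) f ^ (1 - δ) *
          WeightedBesov.besovNorm P s r ∞ (WeightedBesov.weightV p q r v) f ^ δ by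
    obtain ⟨C, hδ0, hδ1, hC⟩ := h
    refine ⟨C, fun u v hu hv huv hu1 hv1 f ⟨hA, hB⟩ => ?_⟩
    have key := hC u v hu hv huv hu1 hv1 f (ne_of_lt hA) (ne_of_lt hB)
    refine ⟨lt_of_le_of_lt key (ENNReal.mul_lt_top (ENNReal.mul_lt_top ENNReal.coe_lt_top ?_) ?_),
      fun _ => key⟩
    · exact ENNReal.rpow_lt_top_of_nonneg (by linarith) (ne_of_lt hA)
    · exact ENNReal.rpow_lt_top_of_nonneg hδ0 (ne_of_lt hB)
  have hss : 0 < s - σ := sub_pos.2 hσs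
  have hτ : τ = σ + θ * (s - σ) := by rw [hθ, div_mul_cancel₀ _ hss.ne']; ring
  rcases hpqr with ⟨h0, h1, h2⟩ | ⟨h0, h1, h2⟩
  · have hqr : 0 < WeightedBesov.recip q - WeightedBesov.recip r :=
      sub_pos.2 (WeightedBesov.recip_lt_recip h0 (h1.trans h2))
    -- The condition on `θ` says `θ < β`, which is `τ < (1-β)σ + βs`, the positivity of `b`.
    have hβ : θ < (WeightedBesov.recip q - WeightedBesov.recip p)
        / (WeightedBesov.recip q - WeightedBesov.recip r) := by
      rw [lt_div_iff₀ hqr]; linarith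
    obtain ⟨d0, d1, -, hmain⟩ := WeightedBesov.exists_besovNorm_le n h0 h1 h2 hη hη' (τ := τ)
      (σ := σ) (s := s) rfl (Or.inl ⟨by linarith [hq h1],
        by nlinarith [mul_lt_mul_of_pos_right hβ hss]⟩)
    obtain ⟨C, hC⟩ := hmain P
    rw [← hδ] at d0 d1 hC
    exact ⟨C, d0, d1, fun u v hu hv huv hu1 _ f hA hB => hC u v hu hv huv (hu1 h1) f hA hB⟩
  · have hqr : 0 < WeightedBesov.recip r - WeightedBesov.recip q :=
      sub_pos.2 (WeightedBesov.recip_lt_recip h0 (h1.trans h2))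
    have hβ : 1 - θ < (WeightedBesov.recip r - WeightedBesov.recip p)
        / (WeightedBesov.recip r - WeightedBesov.recip q) := by
      rw [lt_div_iff₀ hqr]; linarith
    -- The smaller integrability exponent `r` now goes with the larger smoothness `s`, so both `a`
    -- and `b` are negative.
    obtain ⟨d0, d1, hD, hmain⟩ := WeightedBesov.exists_besovNorm_le n h0 h1 h2 hη hη' (τ := τ)
      (σ := s) (s := σ) rfl (Or.inr ⟨by linarith [hr h1],
        by nlinarith [mul_lt_mul_of_pos_right hβ hss]⟩)
    obtain ⟨C, hC⟩ := hmain P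
    have hδ' : (τ - s + n * (WeightedBesov.recip r - WeightedBesov.recip p))
        / (σ - s + n * (WeightedBesov.recip r - WeightedBesov.recip q)) = 1 - δ := by
      have hD' : s - σ + n * (WeightedBesov.recip q - WeightedBesov.recip r) ≠ 0 :=
        fun h => hD (by linarith)
      rw [hδ, eq_sub_iff_add_eq, div_add_div _ _ hD hD', div_eq_one_iff_eq (mul_ne_zero hD hD')]
      ring
    rw [hδ'] at d0 d1 hC
    refine ⟨C, by linarith, by linarith, fun u v hu hv huv _ hv1 f hA hB => ?_⟩
    rw [WeightedBesov.weightU_swap h1 h2, WeightedBesov.weightV_swap h1 h2] at *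
    refine (hC v u hv hu (fun x => by rw [mul_comm]; exact huv x) (hv1 h1) f hB hA).trans_eq ?_
    rw [sub_sub_cancel]
    ring
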